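/- Let $N\in\{2,3\}$ and $\beta\in\mathbb{R}$. For a continuous radial function $w:\mathbb{R}^N\to\mathbb{R}$ let the nodal number $n(w)\in\{0,1,2,\dots\}\cup\{\infty\}$ be the largest $k$ for which there are radii $0<r_0<r_1<\dots<r_k$ such that $w|_{|x|=r_{i-1}}\cdot w|_{|x|=r_i}<0$ for all $i=1,\dots,k$ (and $n(w)=\infty$ if there is no largest such $k$). Let $u,v\in C^2(\mathbb{R}^N)$ be bounded, radial, real-valued functions that satisfy $$-\Delta u=u^3+\beta uv^2,\qquad -\Delta v=v^3+\beta u^2v\qquad\text{in }\mathbb{R}^N,$$ and suppose that $n(u+v)<\infty$ and $n(u-v)<\infty$. If $\beta\neq-1$, then $u\equiv v\equiv 0$. If $\beta=-1$, then there is a constant $c\in\mathbb{R}$ such that $(u,v)\equiv(c,-c)$ or $(u,v)\equiv(c,c)$. -/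

import Mathlib

open scoped Laplacian

/-- A function on `ℝ^N` is radial if its value depends only on the Euclidean norm. -/
def IsRadial {N : ℕ} (u : EuclideanSpace ℝ (Fin N) → ℝ) : Prop :=
  ∀ x y, ‖x‖ = ‖y‖ → u x = u y

/-- There are radii `0 < r₀ < r₁ < ⋯ < r_k` such that the values of `u` on consecutive spheres
`|x| = r_i`, `|x| = r_{i+1}` have opposite (nonzero) signs. -/
def HasSignChanges {N : ℕ} (u : EuclideanSpace ℝ (Fin N) → ℝ) (k : ℕ) : Prop :=
  ∃ r : Fin (k + 1) → ℝ, StrictMono r ∧ (∀ i, 0 < r i) ∧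
    ∀ i : Fin k, ∀ x y : EuclideanSpace ℝ (Fin N),
      ‖x‖ = r i.castSucc → ‖y‖ = r i.succ → u x * u y < 0

/-- The nodal number of a radial function on `ℝ^N`: the largest `k` such that `u` has `k`
successive sign changes along the radius, and `⊤` if there is no largest one. -/
noncomputable def nodalNumber {N : ℕ} (u : EuclideanSpace ℝ (Fin N) → ℝ) : ℕ∞ :=
  ⨆ (k : ℕ) (_ : HasSignChanges u k), (k : ℕ∞)

/-- `(u, v)` is a bounded radial `C²` solution on `ℝ^N` of
`-Δu = u³ + β u v²`, `-Δv = v³ + β u² v`. -/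
structure IsBoundedRadialSolution {N : ℕ} (β : ℝ) (u v : EuclideanSpace ℝ (Fin N) → ℝ) :
    Prop where
  contDiff_u : ContDiff ℝ 2 u
  contDiff_v : ContDiff ℝ 2 v
  bounded_u : ∃ C : ℝ, ∀ x, |u x| ≤ C
  bounded_v : ∃ C : ℝ, ∀ x, |v x| ≤ C
  radial_u : IsRadial u
  radial_v : IsRadial v
  eq_u : ∀ x, -(Δ u) x = u x ^ 3 + β * u x * v x ^ 2
  eq_v : ∀ x, -(Δ v) x = v x ^ 3 + β * u x ^ 2 * v x

open Filter Topology

/-! ### Growth and concavity on half-lines -/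

section Tools

/-! In the plane put `U t = u (e^t)`, in space put `U s = s u(s)`, and likewise for `v`. Both
settings become the one-dimensional system `-U'' = g (U³ + β U V²)`, `-V'' = g (V³ + β U² V)` with
`g ≥ 1/s²` near infinity. Finite nodal numbers make `U + V` and `U - V` eventually one-signed, so
after exchanging components and flipping signs `|V| ≤ U` near infinity. The weight `1/s²` is just
heavy enough to exclude nontrivial concave positive solutions
(`eq_zero_or_eq_zero_of_coupled_concave`).

If `β > -1`, then `U'' ≤ -c U³/s²` and the solution vanishes near infinity. If `β < -1`, then `V²`
is convex and superlinearly forced, hence nonincreasing by the growth bound. So `V` is eventually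
one-signed and decays, and concavity of `U - m V` or `U + m V` for a suitable `m` transfers the
decay to `U` (`noncooperative_decay`). In both cases a Pohozaev quantity `Q` has derivative `U'² +
V'²` and has no mass at either end, so `U` and `V` are constant, and by decay zero
(`planar_eq_zero`, `spatial_eq_zero`).

If `β = -1`, the functions `A = U + V` and `B = U - V` satisfy `A'' = -g A B²`, `B'' = -g B A²`. One
of them vanishes near infinity, and by uniqueness for linear equations everywhere
(`critical_affine`). The nonlinearity then disappears, `U` is affine, and regularity of `u` at the
origin leaves only constants. -/

theorem le_of_hasDerivAt_nonneg {f f' : ℝ → ℝ} {R s t : ℝ}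
    (hf : ∀ x > R, HasDerivAt f (f' x) x) (h0 : ∀ x > R, 0 ≤ f' x) (hs : R < s) (hst : s ≤ t) :
    f s ≤ f t := by
  have hm : MonotoneOn f (Set.Ioi R) := by
    apply monotoneOn_of_hasDerivWithinAt_nonneg (convex_Ioi R)
      (fun x hx => (hf x hx).continuousAt.continuousWithinAt) (f' := f')
    · intro x hx
      rw [interior_Ioi] at hx
      exact (hf x hx).hasDerivWithinAt
    · intro x hx
      rw [interior_Ioi] at hx
      exact h0 x hx
  exact hm hs (lt_of_lt_of_le hs hst) hst

theorem ge_of_hasDerivAt_nonpos {f f' : ℝ → ℝ} {R s t : ℝ}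
    (hf : ∀ x > R, HasDerivAt f (f' x) x) (h0 : ∀ x > R, f' x ≤ 0) (hs : R < s) (hst : s ≤ t) :
    f t ≤ f s := by
  have := le_of_hasDerivAt_nonneg (f := fun x => -f x) (f' := fun x => -f' x)
    (fun x hx => (hf x hx).neg) (fun x hx => by linarith [h0 x hx]) hs hst
  linarith

/-- A derivative bounded below by a power forces growth at the rate of the next power. -/
theorem exists_pow_le_of_deriv_ge {f f' : ℝ → ℝ} {S q : ℝ} (n : ℕ) (hq : 0 < q)
    (hf : ∀ x > S, HasDerivAt f (f' x) x) (h : ∀ x > S, q * x ^ n ≤ f' x) :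
    ∃ T ≥ S, ∃ p > 0, ∀ x > T, p * x ^ (n + 1) ≤ f x := by
  have hn : (0 : ℝ) < n + 1 := by positivity
  -- Integration gives the coefficient `q / (n + 1)`; half of it is given up to absorb the constant
  -- of integration.
  set p := q / (2 * (n + 1)) with hp
  have hp0 : 0 < p := by positivity
  set s := S + 1
  have hmono : ∀ x ≥ s, f s - 2 * p * s ^ (n + 1) ≤ f x - 2 * p * x ^ (n + 1) := by
    intro x hx
    refine le_of_hasDerivAt_nonneg (R := S) (f := fun x => f x - 2 * p * x ^ (n + 1))
      (f' := fun x => f' x - 2 * p * ((n + 1 : ℕ) * x ^ n)) ?_ ?_ (by simp [s]) hx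
    · intro x hx
      exact (hf x hx).sub ((hasDerivAt_pow (n + 1) x).const_mul (2 * p))
    · intro x hx
      have := h x hx
      have h2 : 2 * p * (((n + 1 : ℕ) : ℝ) * x ^ n) = q * x ^ n := by
        rw [hp]; push_cast; field_simp
      rw [h2]; linarith
  have ht : Tendsto (fun x : ℝ => p * x ^ (n + 1)) atTop atTop :=
    (tendsto_pow_atTop (Nat.succ_ne_zero n)).const_mul_atTop hp0
  obtain ⟨T, hT⟩ := eventually_atTop.1 (ht.eventually_ge_atTop (-(f s - 2 * p * s ^ (n + 1))))
  refine ⟨max T s, le_trans (by simp [s]) (le_max_right _ _), p, hp0, fun x hx => ?_⟩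
  have h1 := hT x (le_of_lt (lt_of_le_of_lt (le_max_left _ _) hx))
  have h2 := hmono x (le_of_lt (lt_of_le_of_lt (le_max_right _ _) hx))
  linarith

/-- A function whose derivative is eventually bounded below by a positive constant is unbounded
above. -/
theorem not_bddAbove_of_deriv_ge {f f' : ℝ → ℝ} {S q M : ℝ} (hq : 0 < q)
    (hf : ∀ x > S, HasDerivAt f (f' x) x) (h : ∀ x > S, q ≤ f' x) (hM : ∀ x > S, f x ≤ M) :
    False := by
  obtain ⟨T, hTS, p, hp, hT⟩ := exists_pow_le_of_deriv_ge 0 hq hf (by simpa using h)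
  have h1 := hT (max T (M / p) + 1) (lt_of_le_of_lt (le_max_left _ _) (lt_add_one _))
  have h2 := hM (max T (M / p) + 1)
    (lt_of_le_of_lt (hTS.le.trans (le_max_left _ _)) (lt_add_one _))
  have h3 : M / p < max T (M / p) + 1 := lt_of_le_of_lt (le_max_right _ _) (lt_add_one _)
  rw [div_lt_iff₀ hp] at h3
  simp only [zero_add, pow_one] at h1
  linarith [mul_comm p (max T (M / p) + 1)]

/-- A concave function bounded below on a half-line is nondecreasing. -/
theorem deriv_nonneg_of_concave_of_bddBelow {f f' f'' : ℝ → ℝ} {R m : ℝ}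
    (hf : ∀ x > R, HasDerivAt f (f' x) x) (hf' : ∀ x > R, HasDerivAt f' (f'' x) x)
    (h : ∀ x > R, f'' x ≤ 0) (hm : ∀ x > R, m ≤ f x) : ∀ x > R, 0 ≤ f' x := by
  intro s hs
  by_contra! hneg
  refine not_bddAbove_of_deriv_ge (f := fun x => -f x) (f' := fun x => -f' x) (S := s)
    (q := -f' s) (M := -m) (by linarith) (fun x hx => (hf x (hs.trans hx)).neg) (fun x hx => ?_)
    (fun x hx => by linarith [hm x (hs.trans hx)])
  linarith [ge_of_hasDerivAt_nonpos hf' h hs (le_of_lt hx)]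

/-- `f' ≥ k / s` follows from `f'' ≤ -k / s²` and `f' ≥ 0`. -/
theorem div_le_deriv_of_deriv2_le {f' f'' : ℝ → ℝ} {s k : ℝ} (hs : 0 < s)
    (hf' : ∀ x > s, HasDerivAt f' (f'' x) x) (hc : ContinuousAt f' s)
    (h : ∀ x > s, f'' x ≤ -(k / x ^ 2)) (h0 : ∀ x > s, 0 ≤ f' x) : k / s ≤ f' s := by
  have key : ∀ x > s, k / x ≤ f' x := by
    intro x hx
    -- As `y → ∞` the left side is bounded below by `-k / y → 0`, which gives `k / x ≤ f' x`.
    have hanti : ∀ y ≥ x, f' y - k / y ≤ f' x - k / x := by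
      intro y hy
      refine ge_of_hasDerivAt_nonpos (R := s) (f := fun x => f' x - k / x)
        (f' := fun x => f'' x + k / x ^ 2) ?_ ?_ hx hy
      · intro z hz
        have hz0 : z ≠ 0 := (hs.trans hz).ne'
        exact ((hf' z hz).sub ((hasDerivAt_inv hz0).const_mul k)).congr_deriv (by field_simp; ring)
      · intro z hz
        linarith [h z hz]
    have hl : Tendsto (fun y : ℝ => -(k / y)) atTop (𝓝 0) := by
      simpa using (tendsto_const_nhds (x := k)).div_atTop tendsto_id |>.neg
    have := le_of_tendsto hl (b := f' x - k / x) (by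
      filter_upwards [eventually_ge_atTop x] with y hy
      linarith [hanti y hy, h0 y (lt_of_lt_of_le hx hy)])
    linarith
  have hk : ContinuousAt (fun x => k / x) s := by
    apply ContinuousAt.div continuousAt_const continuousAt_id hs.ne'
  refine le_of_tendsto_of_tendsto (hk.tendsto.mono_left (nhdsWithin_le_nhds (s := Set.Ioi s)))
    (hc.tendsto.mono_left nhdsWithin_le_nhds) ?_
  filter_upwards [self_mem_nhdsWithin] with x hx using key x hx

/-- A function with `f' ≥ k / s`, `k > 0`, is unbounded. -/
theorem tendsto_atTop_of_div_le_deriv {f f' : ℝ → ℝ} {s k : ℝ} (hs : 0 < s) (hk : 0 < k)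
    (hf : ∀ x > s, HasDerivAt f (f' x) x) (h : ∀ x > s, k / x ≤ f' x) :
    Tendsto f atTop atTop := by
  have hmono : ∀ y ≥ s + 1, f (s + 1) - k * Real.log (s + 1) ≤ f y - k * Real.log y := by
    intro y hy
    refine le_of_hasDerivAt_nonneg (R := s) (f := fun x => f x - k * Real.log x)
      (f' := fun x => f' x - k * x⁻¹) ?_ ?_ (lt_add_one s) hy
    · intro z hz
      exact (hf z hz).sub ((Real.hasDerivAt_log (hs.trans hz).ne').const_mul k)
    · intro z hz
      have := h z hz
      rw [div_eq_mul_inv] at this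
      linarith
  have hl : Tendsto (fun y => k * Real.log y + (f (s + 1) - k * Real.log (s + 1))) atTop atTop :=
    tendsto_atTop_add_const_right _ _ (Real.tendsto_log_atTop.const_mul_atTop hk)
  refine tendsto_atTop_mono' _ ?_ hl
  filter_upwards [eventually_ge_atTop (s + 1)] with y hy
  linarith [hmono y hy]

/-- For a convergent function with monotone derivative, `s f'(s) → 0`. -/
theorem tendsto_mul_deriv_of_concave {f f' f'' : ℝ → ℝ} {R l : ℝ} (hR : 0 ≤ R)
    (hf : ∀ x > R, HasDerivAt f (f' x) x) (hf' : ∀ x > R, HasDerivAt f' (f'' x) x)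
    (h : ∀ x > R, f'' x ≤ 0) (h0 : ∀ x > R, 0 ≤ f' x) (hl : Tendsto f atTop (𝓝 l)) :
    Tendsto (fun s => s * f' s) atTop (𝓝 0) := by
  -- Since `f'` is nonincreasing, `f' s` is at most the mean slope over `[s/2, s]`.
  have hb : ∀ s > 2 * R, s * f' s ≤ 2 * (f s - f (s / 2)) := by
    intro s hs
    have hs2 : R < s / 2 := by linarith
    obtain ⟨c, hc, hce⟩ := exists_hasDerivAt_eq_slope f f' (a := s / 2) (b := s) (by linarith)
      (fun x hx => (hf x (by linarith [hx.1])).continuousAt.continuousWithinAt)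
      (fun x hx => hf x (by linarith [hx.1]))
    have := ge_of_hasDerivAt_nonpos hf' h (s := c) (t := s) (by linarith [hc.1]) hc.2.le
    rw [hce, le_div_iff₀ (by linarith)] at this
    linarith
  have hlim : Tendsto (fun s => 2 * (f s - f (s / 2))) atTop (𝓝 0) := by
    have h2 : Tendsto (fun s : ℝ => f (s / 2)) atTop (𝓝 l) :=
      hl.comp (tendsto_id.atTop_div_const (by norm_num))
    simpa using (hl.sub h2).const_mul 2
  refine tendsto_of_tendsto_of_tendsto_of_le_of_le' tendsto_const_nhds hlim ?_ ?_
  · filter_upwards [eventually_gt_atTop R] with s hs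
    exact mul_nonneg (by linarith) (h0 s hs)
  · filter_upwards [eventually_gt_atTop (2 * R)] with s hs using hb s hs

end Tools

/-! ### Vanishing of concave solutions -/

/-- Two nonnegative functions with `A'' ≤ -c A B² / s²` and `B'' ≤ -c B A² / s²` on a half-line:
one of them vanishes. -/
theorem eq_zero_or_eq_zero_of_coupled_concave {A A' A'' B B' B'' : ℝ → ℝ} {R c : ℝ} (hR : 0 ≤ R)
    (hc : 0 < c)
    (hA : ∀ x > R, HasDerivAt A (A' x) x) (hA' : ∀ x > R, HasDerivAt A' (A'' x) x)
    (hB : ∀ x > R, HasDerivAt B (B' x) x) (hB' : ∀ x > R, HasDerivAt B' (B'' x) x)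
    (hA0 : ∀ x > R, 0 ≤ A x) (hB0 : ∀ x > R, 0 ≤ B x)
    (hAc : ∀ x > R, A'' x ≤ -(c * A x * B x ^ 2 / x ^ 2))
    (hBc : ∀ x > R, B'' x ≤ -(c * B x * A x ^ 2 / x ^ 2)) :
    (∀ x > R, A x = 0) ∨ (∀ x > R, B x = 0) := by
  by_contra! hcon
  obtain ⟨⟨a, haR, ha⟩, ⟨b, hbR, hb⟩⟩ := hcon
  have hA2 : ∀ x > R, A'' x ≤ 0 := fun x hx => (hAc x hx).trans (by
    have := hA0 x hx
    exact neg_nonpos.2 (by positivity))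
  have hB2 : ∀ x > R, B'' x ≤ 0 := fun x hx => (hBc x hx).trans (by
    have := hB0 x hx
    exact neg_nonpos.2 (by positivity))
  have hA1 := deriv_nonneg_of_concave_of_bddBelow hA hA' hA2 hA0
  have hB1 := deriv_nonneg_of_concave_of_bddBelow hB hB' hB2 hB0
  have hAm : ∀ s t, R < s → s ≤ t → A s ≤ A t := fun s t => le_of_hasDerivAt_nonneg hA hA1
  have hBm : ∀ s t, R < s → s ≤ t → B s ≤ B t := fun s t => le_of_hasDerivAt_nonneg hB hB1
  have hApos : 0 < A a := lt_of_le_of_ne (hA0 a haR) (Ne.symm ha)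
  have hBpos : 0 < B b := lt_of_le_of_ne (hB0 b hbR) (Ne.symm hb)
  -- Both functions are nondecreasing, so their values at `s` may be frozen when `A''` is integrated
  -- from `s` to infinity.
  have key : ∀ s > R, c * A s * B s ^ 2 / s ≤ A' s := by
    intro s hs
    refine div_le_deriv_of_deriv2_le (lt_of_le_of_lt hR hs) (fun x hx => hA' x (hs.trans hx))
      (hA' s hs).continuousAt (fun x hx => (hAc x (hs.trans hx)).trans ?_)
      (fun x hx => hA1 x (hs.trans hx))
    have h1 := hAm s x hs (le_of_lt hx)
    have h2 := hBm s x hs (le_of_lt hx)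
    have h3 := hA0 s hs
    have h4 := hB0 s hs
    have h5 := h3.trans h1
    have h6 := h4.trans h2
    apply neg_le_neg
    gcongr
  have keyB : ∀ s > R, c * B s * A s ^ 2 / s ≤ B' s := by
    intro s hs
    refine div_le_deriv_of_deriv2_le (lt_of_le_of_lt hR hs) (fun x hx => hB' x (hs.trans hx))
      (hB' s hs).continuousAt (fun x hx => (hBc x (hs.trans hx)).trans ?_)
      (fun x hx => hB1 x (hs.trans hx))
    have h1 := hAm s x hs (le_of_lt hx)
    have h2 := hBm s x hs (le_of_lt hx)
    have h3 := hA0 s hs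
    have h4 := hB0 s hs
    have h5 := h3.trans h1
    have h6 := h4.trans h2
    apply neg_le_neg
    gcongr
  set s₀ := max a b with hs₀
  have hs₀R : R < s₀ := lt_of_lt_of_le haR (le_max_left _ _)
  have hs₀0 : 0 < s₀ := lt_of_le_of_lt hR hs₀R
  have hBge : ∀ x > s₀, B b ≤ B x := fun x hx =>
    hBm b x hbR ((le_max_right _ _).trans (le_of_lt hx))
  have hAge : ∀ x > s₀, A a ≤ A x := fun x hx =>
    hAm a x haR ((le_max_left _ _).trans (le_of_lt hx))
  have hAtop : Tendsto A atTop atTop := by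
    refine tendsto_atTop_of_div_le_deriv (k := c * A a * B b ^ 2) hs₀0 (by positivity)
      (fun x hx => hA x (hs₀R.trans hx)) (fun x hx => (key x (hs₀R.trans hx)).trans' ?_)
    have h1 := hBge x hx
    have h2 := hAge x hx
    have : 0 < x := hs₀0.trans hx
    have h3 := hApos.le.trans h2
    have h4 := hBpos.le.trans h1
    gcongr
  have hBtop : Tendsto B atTop atTop := by
    refine tendsto_atTop_of_div_le_deriv (k := c * B b * A a ^ 2) hs₀0 (by positivity)
      (fun x hx => hB x (hs₀R.trans hx)) (fun x hx => (keyB x (hs₀R.trans hx)).trans' ?_)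
    have h1 := hBge x hx
    have h2 := hAge x hx
    have : 0 < x := hs₀0.trans hx
    have h3 := hApos.le.trans h2
    have h4 := hBpos.le.trans h1
    gcongr
  have hB2top : Tendsto (fun x => c * B x ^ 2) atTop atTop :=
    ((tendsto_pow_atTop two_ne_zero).comp hBtop).const_mul_atTop hc
  -- This bounds `t A' - A` from above. Once `c B² ≥ 2`, `key` gives `t A' ≥ 2 A`, so `A` would be
  -- bounded, against `A → ∞`.
  have hanti : ∀ s t, R < s → s ≤ t → t * A' t - A t ≤ s * A' s - A s := by
    intro s t
    refine ge_of_hasDerivAt_nonpos (f := fun x => x * A' x - A x) (f' := fun x => x * A'' x) ?_ ?_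
    · intro x hx
      exact (((hasDerivAt_id x).mul (hA' x hx)).sub (hA x hx)).congr_deriv (by simp)
    · intro x hx
      exact mul_nonpos_of_nonneg_of_nonpos (by linarith) (hA2 x hx)
  obtain ⟨t, ht1, ht2, ht3⟩ := ((hB2top.eventually_ge_atTop 2).and
    ((eventually_gt_atTop s₀).and (hAtop.eventually_gt_atTop (s₀ * A' s₀ - A s₀)))).exists
  have h1 := hanti s₀ t hs₀R ht2.le
  have h2 := key t (hs₀R.trans ht2)
  have ht0 : 0 < t := hs₀0.trans ht2
  rw [div_le_iff₀ ht0] at h2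
  have h3 := hA0 t (hs₀R.trans ht2)
  nlinarith [mul_nonneg h3 (sub_nonneg.2 ht1)]

/-- The diagonal case `A = B = y` of the coupled statement. -/
theorem eq_zero_of_cubic_concave {y y' y'' : ℝ → ℝ} {R c : ℝ} (hR : 0 ≤ R) (hc : 0 < c)
    (hy : ∀ x > R, HasDerivAt y (y' x) x) (hy' : ∀ x > R, HasDerivAt y' (y'' x) x)
    (hy0 : ∀ x > R, 0 ≤ y x) (h : ∀ x > R, y'' x ≤ -(c * y x ^ 3 / x ^ 2)) :
    ∀ x > R, y x = 0 := by
  have h' : ∀ x > R, y'' x ≤ -(c * y x * y x ^ 2 / x ^ 2) := fun x hx => by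
    convert h x hx using 3; ring
  simpa using eq_zero_or_eq_zero_of_coupled_concave hR hc hy hy' hy hy' hy0 hy0 h' h'

/-! ### The reduced system and its symmetries -/

/-- On `D`, `(U, V)` solves the one-dimensional system `-U'' = g (U³ + β U V²)`,
`-V'' = g (V³ + β U² V)`. -/
structure IsReducedSolution (β : ℝ) (g U U' V V' : ℝ → ℝ) (D : Set ℝ) : Prop where
  hasDerivAt_fst : ∀ s ∈ D, HasDerivAt U (U' s) s
  hasDerivAt_fst' : ∀ s ∈ D, HasDerivAt U' (-(g s * (U s ^ 3 + β * U s * V s ^ 2))) s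
  hasDerivAt_snd : ∀ s ∈ D, HasDerivAt V (V' s) s
  hasDerivAt_snd' : ∀ s ∈ D, HasDerivAt V' (-(g s * (V s ^ 3 + β * U s ^ 2 * V s))) s

namespace IsReducedSolution

variable {β : ℝ} {g U U' V V' : ℝ → ℝ} {D E : Set ℝ}

theorem mono (h : IsReducedSolution β g U U' V V' D) (hE : E ⊆ D) :
    IsReducedSolution β g U U' V V' E :=
  ⟨fun s hs => h.1 s (hE hs), fun s hs => h.2 s (hE hs), fun s hs => h.3 s (hE hs),
    fun s hs => h.4 s (hE hs)⟩

theorem swap (h : IsReducedSolution β g U U' V V' D) : IsReducedSolution β g V V' U U' D :=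
  ⟨h.3, fun s hs => (h.4 s hs).congr_deriv (by ring), h.1,
    fun s hs => (h.2 s hs).congr_deriv (by ring)⟩

theorem neg_fst (h : IsReducedSolution β g U U' V V' D) :
    IsReducedSolution β g (fun s => -U s) (fun s => -U' s) V V' D :=
  ⟨fun s hs => (h.1 s hs).neg, fun s hs => (h.2 s hs).neg.congr_deriv (by ring), h.3,
    fun s hs => (h.4 s hs).congr_deriv (by ring)⟩

theorem neg_snd (h : IsReducedSolution β g U U' V V' D) :
    IsReducedSolution β g U U' (fun s => -V s) (fun s => -V' s) D :=
  h.swap.neg_fst.swap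

end IsReducedSolution

/-- The decay at infinity of a solution of the one-dimensional system which makes the boundary
terms of the Pohozaev identity vanish. -/
structure DecaysAtTop (g U U' V V' : ℝ → ℝ) : Prop where
  fst : Tendsto U atTop (𝓝 0)
  fst' : Tendsto (fun s => s * U' s) atTop (𝓝 0)
  snd : Tendsto V atTop (𝓝 0)
  snd' : Tendsto (fun s => s * V' s) atTop (𝓝 0)
  freq : ∀ ε > 0, ∃ᶠ s in atTop, g s * (|U s| ^ 3 + |V s| ^ 3) < ε

namespace DecaysAtTop

variable {g U U' V V' : ℝ → ℝ}

theorem swap (h : DecaysAtTop g U U' V V') : DecaysAtTop g V V' U U' :=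
  ⟨h.3, h.4, h.1, h.2, fun ε hε => (h.5 ε hε).mono fun s hs => by rwa [add_comm]⟩

theorem of_neg_fst (h : DecaysAtTop g (fun s => -U s) (fun s => -U' s) V V') :
    DecaysAtTop g U U' V V' :=
  ⟨by simpa using h.1.neg, by simpa using h.2.neg, h.3, h.4, by simpa using h.5⟩

theorem of_neg_snd (h : DecaysAtTop g U U' (fun s => -V s) (fun s => -V' s)) :
    DecaysAtTop g U U' V V' :=
  h.swap.of_neg_fst.swap

end DecaysAtTop

/-! ### Decay near infinity for `β ≠ -1` -/

section Exterior

variable {β C R : ℝ} {g U U' V V' : ℝ → ℝ}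

/-- Because `V² ≤ U²`, one has `U² + β V² ≥ min 1 (1 + β) * U²`, so `U` is a nonnegative solution of
the cubic concave inequality. -/
theorem cooperative_eq_zero (hβ : -1 < β) (hR : 1 ≤ R)
    (h : IsReducedSolution β g U U' V V' (Set.Ioi R)) (hg : ∀ s > R, 1 / s ^ 2 ≤ g s)
    (hUV : ∀ s > R, |V s| ≤ U s) : ∀ s > R, U s = 0 ∧ V s = 0 := by
  have hU0 : ∀ s > R, 0 ≤ U s := fun s hs => (abs_nonneg _).trans (hUV s hs)
  obtain ⟨c, hc, hc1, hc2⟩ : ∃ c > 0, c ≤ 1 ∧ c ≤ 1 + β :=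
    ⟨min 1 (1 + β), lt_min one_pos (by linarith), min_le_left _ _, min_le_right _ _⟩
  have key : ∀ s > R, U s = 0 := by
    refine eq_zero_of_cubic_concave (by linarith) hc h.1 h.2 hU0 fun s hs => ?_
    have h0 := hU0 s hs
    have hV : V s ^ 2 ≤ U s ^ 2 := sq_le_sq' (by linarith [(abs_le.1 (hUV s hs)).1])
      (abs_le.1 (hUV s hs)).2
    have h1 : c * U s ^ 2 ≤ U s ^ 2 + β * V s ^ 2 := by
      rcases le_total 0 β with hb | hb
      · nlinarith [sq_nonneg (U s), sq_nonneg (V s), mul_nonneg hb (sq_nonneg (V s))]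
      · nlinarith [sq_nonneg (U s), mul_nonneg (neg_nonneg.2 hb) (sub_nonneg.2 hV)]
    have h2 : c * U s ^ 3 ≤ U s ^ 3 + β * U s * V s ^ 2 := by
      nlinarith [mul_le_mul_of_nonneg_left h1 h0]
    have h3 : 0 ≤ c * U s ^ 3 := by positivity
    have h4 := mul_le_mul (hg s hs) h2 h3 ((by positivity : (0:ℝ) ≤ 1 / s ^ 2).trans (hg s hs))
    apply neg_le_neg
    rwa [one_div, inv_mul_eq_div] at h4
  refine fun s hs => ⟨key s hs, ?_⟩
  have := hUV s hs
  rw [key s hs] at this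
  exact abs_nonpos_iff.1 this

/-- A nonnegative function with at most quadratic growth and `y'' ≥ k y² / s²` is nonincreasing. -/
theorem deriv_nonpos_of_deriv2_ge {y y' y'' : ℝ → ℝ} {k M : ℝ} (hR : 1 ≤ R) (hk : 0 < k)
    (hy : ∀ x > R, HasDerivAt y (y' x) x) (hy' : ∀ x > R, HasDerivAt y' (y'' x) x)
    (hM : ∀ x > R, y x ≤ M * x ^ 2)
    (h : ∀ x > R, k * y x ^ 2 / x ^ 2 ≤ y'' x) : ∀ x > R, y' x ≤ 0 := by
  intro s hs
  by_contra! hpos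
  have h0 : ∀ x > R, 0 ≤ y'' x := fun x hx => (h x hx).trans' (by positivity)
  -- Bootstrap: inserting a lower bound of order `n + 1` into `y'' ≥ k y² / x²` and integrating
  -- twice doubles the order. A positive slope gives order 1, then 2, then 4, which beats the
  -- quadratic upper bound.
  have hstep : ∀ (n : ℕ) (S p : ℝ), R ≤ S → 0 < p → (∀ x > S, p * x ^ (n + 1) ≤ y x) →
      ∃ T ≥ S, ∃ q > 0, ∀ x > T, q * x ^ (2 * n + 2) ≤ y x := by
    intro n S p hS hp hlow
    obtain ⟨T, hT, q, hq, hqT⟩ := exists_pow_le_of_deriv_ge (f := y') (f' := y'') (S := S)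
      (q := k * p ^ 2) (2 * n) (by positivity) (fun x hx => hy' x (hS.trans_lt hx)) (by
        intro x hx
        have hx0 : 0 < x := by linarith
        refine (h x (hS.trans_lt hx)).trans' ?_
        rw [le_div_iff₀ (by positivity)]
        have h2 : 0 ≤ p * x ^ (n + 1) := by positivity
        have h1 := pow_le_pow_left₀ h2 (hlow x hx) 2
        calc k * p ^ 2 * x ^ (2 * n) * x ^ 2 = k * (p * x ^ (n + 1)) ^ 2 := by ring
          _ ≤ k * y x ^ 2 := by gcongr)
    obtain ⟨T', hT', q', hq', hqT'⟩ := exists_pow_le_of_deriv_ge (f := y) (f' := y') (S := T)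
      (2 * n + 1) hq (fun x hx => hy x (by linarith)) hqT
    exact ⟨T', by linarith, q', hq', hqT'⟩
  obtain ⟨S₁, hS₁, p₁, hp₁, hlow₁⟩ := exists_pow_le_of_deriv_ge (f := y) (f' := y') (S := s) 0 hpos
    (fun x hx => hy x (hs.trans hx)) (fun x hx => by
      simpa using le_of_hasDerivAt_nonneg hy' h0 hs (le_of_lt hx))
  obtain ⟨S₂, hS₂, p₂, hp₂, hlow₂⟩ := hstep 0 S₁ p₁ (by linarith) hp₁ hlow₁
  obtain ⟨S₃, hS₃, p₃, hp₃, hlow₃⟩ := hstep 1 S₂ p₂ (by linarith) hp₂ hlow₂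
  have ht : Tendsto (fun x : ℝ => p₃ * x ^ 2) atTop atTop :=
    (tendsto_pow_atTop two_ne_zero).const_mul_atTop hp₃
  obtain ⟨x, hx1, hx2⟩ := ((ht.eventually_gt_atTop M).and (eventually_gt_atTop S₃)).exists
  have h1 := hlow₃ x hx2
  have h2 := hM x (by linarith)
  have hx0 : 0 < x := by linarith
  have : 0 < (p₃ * x ^ 2 - M) * x ^ 2 := mul_pos (by linarith) (by positivity)
  have h3 : p₃ * x ^ (2 * 1 + 2) = p₃ * x ^ 2 * x ^ 2 := by ring
  rw [sub_mul] at this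
  linarith

/-- Decay in the noncooperative case, when both components are nonnegative. -/
theorem noncooperative_decay_of_nonneg (hβ : β < -1) (hR : 1 ≤ R)
    (h : IsReducedSolution β g U U' V V' (Set.Ioi R)) (hg : ∀ s > R, 1 / s ^ 2 ≤ g s)
    (hUV : ∀ s > R, V s ≤ U s) (hV0 : ∀ s > R, 0 ≤ V s)
    (hmono : ∀ s > R, V s * V' s ≤ 0) : DecaysAtTop g U U' V V' := by
  obtain ⟨hU, hU', hV, hV'⟩ := h
  simp only [Set.mem_Ioi] at hU hU' hV hV'
  have hg0 : ∀ s > R, 0 ≤ g s := fun s hs => (hg s hs).trans' (by positivity)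
  have hU0 : ∀ s > R, 0 ≤ U s := fun s hs => (hV0 s hs).trans (hUV s hs)
  have hsq : ∀ s > R, V s ^ 2 ≤ U s ^ 2 := fun s hs => pow_le_pow_left₀ (hV0 s hs) (hUV s hs) 2
  set k := -1 - β with hk
  have hk0 : 0 < k := by rw [hk]; linarith
  have hV2 : ∀ s > R, k * V s ^ 3 / s ^ 2 ≤ -(g s * (V s ^ 3 + β * U s ^ 2 * V s)) := by
    intro s hs
    have h1 : k * V s ^ 3 ≤ -(V s ^ 3 + β * U s ^ 2 * V s) := by
      rw [hk]
      nlinarith [mul_nonneg (mul_nonneg (hV0 s hs) (by linarith : 0 ≤ -β))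
        (sub_nonneg.2 (hsq s hs))]
    have h3 : 0 ≤ k * V s ^ 3 := mul_nonneg hk0.le (pow_nonneg (hV0 s hs) 3)
    have h4 := mul_le_mul (hg s hs) h1 h3 (hg0 s hs)
    rw [one_div, inv_mul_eq_div] at h4
    linarith
  have hV2' : ∀ s > R, 0 ≤ -(g s * (V s ^ 3 + β * U s ^ 2 * V s)) := fun s hs =>
    (hV2 s hs).trans' (div_nonneg (mul_nonneg hk0.le (pow_nonneg (hV0 s hs) 3)) (by positivity))
  -- Where `V > 0` this is `hmono`; a zero of `V` is a minimum, so `V'` vanishes there.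
  have hV1 : ∀ s > R, V' s ≤ 0 := by
    intro s hs
    rcases (hV0 s hs).eq_or_lt with h0 | h0
    · have hmin : IsLocalMin V s := by
        filter_upwards [Ioi_mem_nhds hs] with x hx
        rw [← h0]; exact hV0 x hx
      rw [hmin.hasDerivAt_eq_zero (hV s hs)]
    · have := hmono s hs
      by_contra! hc
      nlinarith [mul_pos h0 hc]
  have hVm : ∀ s t, R < s → s ≤ t → V t ≤ V s := fun s t => ge_of_hasDerivAt_nonpos hV hV1
  have hVlim : Tendsto V atTop (𝓝 0) := by
    rw [Metric.tendsto_atTop]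
    by_contra! hcon
    obtain ⟨ε, hε, hcon⟩ := hcon
    -- A positive lower bound on `V` would give `-V' ≥ k ε³ / s`, and `V` would fall below zero
    -- logarithmically.
    have hge : ∀ s > R, ε ≤ V s := by
      intro s hs
      obtain ⟨t, ht, hte⟩ := hcon s
      rw [Real.dist_eq, sub_zero, abs_of_nonneg (hV0 t (hs.trans_le ht))] at hte
      exact hte.trans (hVm s t hs ht)
    have hslope : ∀ s > R, k * ε ^ 3 / s ≤ -V' s := by
      intro s hs
      refine div_le_deriv_of_deriv2_le (f' := fun s => -V' s) (by linarith)
        (fun x hx => (hV' x (hs.trans hx)).neg) (hV' s hs).continuousAt.neg (fun x hx => ?_)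
        (fun x hx => by linarith [hV1 x (hs.trans hx)])
      have h1 := hV2 x (hs.trans hx)
      have h2 := hge x (hs.trans hx)
      have : k * ε ^ 3 / x ^ 2 ≤ k * V x ^ 3 / x ^ 2 := by gcongr
      linarith
    have hR0 : 0 < R := by linarith
    have := tendsto_atTop_of_div_le_deriv (f := fun s => -V s) (f' := fun s => -V' s)
      (k := k * ε ^ 3) hR0 (by positivity) (fun x hx => (hV x hx).neg) hslope
    obtain ⟨x, hx1, hx2⟩ := ((this.eventually_gt_atTop 0).and (eventually_gt_atTop R)).exists
    linarith [hV0 x hx2]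
  have hVd : Tendsto (fun s => s * V' s) atTop (𝓝 0) := by
    have := tendsto_mul_deriv_of_concave (f := fun s => -V s) (f' := fun s => -V' s) (l := -0)
      (by linarith : 0 ≤ R) (fun x hx => (hV x hx).neg) (fun x hx => (hV' x hx).neg)
      (fun x hx => by linarith [hV2' x hx]) (fun x hx => by linarith [hV1 x hx]) hVlim.neg
    simpa using this.neg
  -- Chosen so that `m (-1 - β) = -β`: in `(U - m V)''` the mixed terms, estimated by multiples of
  -- `U² V`, then cancel exactly and leave `-g U³`.
  set m := -β / k with hm
  have hm0 : 0 < m := div_pos (by linarith) hk0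
  have hmk : m * k = -β := by rw [hm]; field_simp
  set Z := fun s => U s - m * V s with hZ
  set Z' := fun s => U' s - m * V' s with hZ'
  set Z'' := fun s => -(g s * (U s ^ 3 + β * U s * V s ^ 2)) -
    m * -(g s * (V s ^ 3 + β * U s ^ 2 * V s)) with hZ''
  have hZd : ∀ s > R, HasDerivAt Z (Z' s) s := fun s hs => (hU s hs).sub ((hV s hs).const_mul m)
  have hZd' : ∀ s > R, HasDerivAt Z' (Z'' s) s := fun s hs =>
    (hU' s hs).sub ((hV' s hs).const_mul m)
  have hZ2 : ∀ s > R, Z'' s ≤ -(g s * U s ^ 3) := by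
    intro s hs
    have h0 := hV0 s hs
    have h0' := hU0 s hs
    have hle := hUV s hs
    have h1 : V s ^ 3 ≤ U s ^ 2 * V s := by nlinarith [mul_le_mul_of_nonneg_left (hsq s hs) h0]
    have h2 : U s * V s ^ 2 ≤ U s ^ 2 * V s := by
      nlinarith [mul_nonneg (mul_nonneg h0 h0') (sub_nonneg.2 hle)]
    have h3 : 0 ≤ -β * U s * V s ^ 2 * (-1) + m * (-β) * U s ^ 2 * V s - m * V s ^ 3 := by
      have e1 := mul_le_mul_of_nonneg_left h1 hm0.le
      have e2 := mul_le_mul_of_nonneg_left h2 (by linarith : 0 ≤ -β)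
      have e3 : m * k * (U s ^ 2 * V s) = -β * (U s ^ 2 * V s) := by rw [hmk]
      rw [hk] at e3
      nlinarith
    have := mul_nonneg (hg0 s hs) h3
    simp only [hZ'']
    nlinarith
  have hZ2' : ∀ s > R, Z'' s ≤ 0 := fun s hs => (hZ2 s hs).trans
    (neg_nonpos.2 (mul_nonneg (hg0 s hs) (pow_nonneg (hU0 s hs) 3)))
  have hRm : R < R + 1 := lt_add_one R
  have hZb : ∀ s > R + 1, -(m * V (R + 1)) ≤ Z s := by
    intro s hs
    have h1 := hVm (R + 1) s hRm (le_of_lt hs)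
    have h2 := mul_le_mul_of_nonneg_left h1 hm0.le
    simp only [hZ]
    linarith [hU0 s (hRm.trans hs)]
  have hZ1 : ∀ s > R + 1, 0 ≤ Z' s := deriv_nonneg_of_concave_of_bddBelow
    (fun x hx => hZd x (hRm.trans hx)) (fun x hx => hZd' x (hRm.trans hx))
    (fun x hx => hZ2' x (hRm.trans hx)) hZb
  -- If `Z` were positive somewhere it would stay positive, and `Z ≤ U` would turn `Z'' ≤ -g U³`
  -- into the cubic inequality for `Z`, forcing `Z = 0`. Hence `U ≤ m V`.
  have hZneg : ∀ s > R + 1, Z s ≤ 0 := by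
    intro s hs
    by_contra! hpos
    have hZge : ∀ x > s, Z s ≤ Z x := fun x hx => le_of_hasDerivAt_nonneg
      (fun x hx => hZd x (hRm.trans hx)) hZ1 hs (le_of_lt hx)
    have hz := eq_zero_of_cubic_concave (y := Z) (y' := Z') (y'' := Z'') (R := s) (c := 1)
      (by linarith) one_pos
      (fun x hx => hZd x (by linarith)) (fun x hx => hZd' x (by linarith))
      (fun x hx => hpos.le.trans (hZge x hx)) (fun x hx => by
        have hxR : x > R := by linarith
        refine (hZ2 x hxR).trans (neg_le_neg ?_)
        have hZx := hpos.le.trans (hZge x hx)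
        have hZU : Z x ≤ U x := by
          simp only [hZ]; linarith [mul_nonneg hm0.le (hV0 x hxR)]
        have h3 := pow_le_pow_left₀ hZx hZU 3
        have h4 := mul_le_mul (hg x hxR) h3 (pow_nonneg hZx 3) (hg0 x hxR)
        rwa [one_div, inv_mul_eq_div, ← one_mul (Z x ^ 3)] at h4)
    have h1 := hz (s + 1) (lt_add_one s)
    have h2 := hZge (s + 1) (lt_add_one s)
    linarith
  have hUlim : Tendsto U atTop (𝓝 0) := by
    have hmV : Tendsto (fun s => m * V s) atTop (𝓝 0) := by simpa using hVlim.const_mul m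
    refine tendsto_of_tendsto_of_tendsto_of_le_of_le' tendsto_const_nhds hmV ?_ ?_
    · filter_upwards [eventually_gt_atTop R] with s hs using hU0 s hs
    · filter_upwards [eventually_gt_atTop (R + 1)] with s hs
      have := hZneg s hs
      simp only [hZ] at this
      linarith
  have hZlim : Tendsto Z atTop (𝓝 (0 - m * 0)) := hUlim.sub (hVlim.const_mul m)
  have hZdl := tendsto_mul_deriv_of_concave (by linarith : 0 ≤ R + 1)
    (fun x hx => hZd x (hRm.trans hx)) (fun x hx => hZd' x (hRm.trans hx))
    (fun x hx => hZ2' x (hRm.trans hx)) hZ1 hZlim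
  refine ⟨hUlim, ?_, hVlim, hVd, ?_⟩
  · have := hZdl.add (hVd.const_mul m)
    simp only [mul_zero, add_zero] at this
    refine this.congr fun s => ?_
    simp only [hZ']
    ring
  -- Otherwise `-Z'' ≥ g U³ ≥ ε / 2` eventually, using `V ≤ U`, and `Z'` could not stay nonnegative.
  -- This yields smallness only along a sequence, which suffices because the Pohozaev quantity is
  -- monotone.
  · intro ε hε
    by_contra hcon
    rw [not_frequently] at hcon
    obtain ⟨S, hS⟩ := eventually_atTop.1 hcon
    refine not_bddAbove_of_deriv_ge (f := fun x => -Z' x) (f' := fun x => -Z'' x)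
      (S := max S (R + 1)) (q := ε / 2) (M := 0) (by linarith)
      (fun x hx => (hZd' x (hRm.trans ((le_max_right _ _).trans_lt hx))).neg) (fun x hx => ?_)
      (fun x hx => by linarith [hZ1 x ((le_max_right _ _).trans_lt hx)])
    have hxR : x > R := hRm.trans ((le_max_right _ _).trans_lt hx)
    have h1 := hS x ((le_max_left _ _).trans hx.le)
    have h2 := hZ2 x hxR
    rw [not_lt, abs_of_nonneg (hU0 x hxR), abs_of_nonneg (hV0 x hxR)] at h1
    have h3 := mul_le_mul_of_nonneg_left (pow_le_pow_left₀ (hV0 x hxR) (hUV x hxR) 3) (hg0 x hxR)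
    linarith

/-- The sign of `V` is not known, but `y = V²` satisfies `y'' ≥ 2 (-1 - β) y² / s²` and grows at
most quadratically, so it is nonincreasing. Therefore a zero of `V` persists, `V` is eventually
one-signed, and a sign flip leads to the nonnegative case. -/
theorem noncooperative_decay (hβ : β < -1) (hR : 1 ≤ R)
    (h : IsReducedSolution β g U U' V V' (Set.Ioi R)) (hg : ∀ s > R, 1 / s ^ 2 ≤ g s)
    (hVC : ∀ s > R, |V s| ≤ C * s)
    (hUV : ∀ s > R, |V s| ≤ U s) : DecaysAtTop g U U' V V' := by
  have hg0 : ∀ s > R, 0 ≤ g s := fun s hs => (hg s hs).trans' (by positivity)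
  have hsq : ∀ s > R, V s ^ 2 ≤ U s ^ 2 := fun s hs =>
    sq_le_sq.2 ((hUV s hs).trans (le_abs_self _))
  have hmono : ∀ s > R, 2 * (V s * V' s) ≤ 0 := by
    refine deriv_nonpos_of_deriv2_ge (y := fun s => V s ^ 2)
      (y'' := fun s => 2 * (V' s * V' s + V s * -(g s * (V s ^ 3 + β * U s ^ 2 * V s))))
      (k := 2 * (-1 - β)) (M := C ^ 2) hR (by linarith) ?_ ?_ ?_ ?_
    · intro s hs
      exact ((h.3 s hs).pow 2).congr_deriv (by simp; ring)
    · intro s hs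
      exact ((h.3 s hs).mul (h.4 s hs)).const_mul 2
    · intro s hs
      rw [← mul_pow]
      exact sq_le_sq.2 ((hVC s hs).trans (le_abs_self _))
    · intro s hs
      have h1 : (-1 - β) * V s ^ 4 ≤ -(V s * (V s ^ 3 + β * U s ^ 2 * V s)) := by
        nlinarith [mul_nonneg (mul_nonneg (sq_nonneg (V s)) (by linarith : 0 ≤ -β))
          (sub_nonneg.2 (hsq s hs))]
      have h3 : 0 ≤ (-1 - β) * V s ^ 4 := mul_nonneg (by linarith) (by positivity)
      have h4 := mul_le_mul (hg s hs) h1 h3 (hg0 s hs)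
      rw [one_div, inv_mul_eq_div] at h4
      have h5 : 2 * (-1 - β) * (V s ^ 2) ^ 2 / s ^ 2 = 2 * ((-1 - β) * V s ^ 4 / s ^ 2) := by ring
      rw [h5]
      nlinarith [mul_self_nonneg (V' s)]
  have hmono' : ∀ s > R, V s * V' s ≤ 0 := fun s hs => by linarith [hmono s hs]
  have hanti : ∀ s t, R < s → s ≤ t → V t ^ 2 ≤ V s ^ 2 := fun s t =>
    ge_of_hasDerivAt_nonpos (f := fun s => V s ^ 2) (f' := fun s => 2 * (V s * V' s))
      (fun s hs => ((h.3 s hs).pow 2).congr_deriv (by simp; ring)) hmono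
  have hsign : ∃ T ≥ R, (∀ s > T, 0 ≤ V s) ∨ (∀ s > T, V s ≤ 0) := by
    by_cases hz : ∃ s > R, V s = 0
    · obtain ⟨s, hs, hs0⟩ := hz
      refine ⟨s, hs.le, Or.inl fun t ht => ?_⟩
      have := hanti s t hs (le_of_lt ht)
      rw [hs0] at this
      have : V t = 0 := by
        have h2 : V t ^ 2 = 0 := le_antisymm (by simpa using this) (sq_nonneg _)
        simpa using h2
      exact this.ge
    · push Not at hz
      refine ⟨R, le_rfl, ?_⟩
      by_contra! hcon
      obtain ⟨⟨a, ha, hVa⟩, ⟨b, hb, hVb⟩⟩ := hcon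
      have hc : ContinuousOn V (Set.Ioi R) := fun s hs => (h.3 s hs).continuousAt.continuousWithinAt
      obtain ⟨c, hcR, hc0⟩ := (convex_Ioi R).isPreconnected.intermediate_value ha hb hc
        ⟨hVa.le, hVb.le⟩
      exact hz c hcR hc0
  obtain ⟨T, hT, hpos | hneg⟩ := hsign
  · exact noncooperative_decay_of_nonneg hβ (hR.trans hT) (h.mono (Set.Ioi_subset_Ioi hT))
      (fun s hs => hg s (hT.trans_lt hs))
      (fun s hs => (le_abs_self _).trans (hUV s (hT.trans_lt hs))) hpos
      (fun s hs => hmono' s (hT.trans_lt hs))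
  · refine DecaysAtTop.of_neg_snd (noncooperative_decay_of_nonneg hβ (hR.trans hT)
      (h.mono (Set.Ioi_subset_Ioi hT)).neg_snd
      (fun s hs => hg s (hT.trans_lt hs))
      (fun s hs => (neg_le_abs _).trans (hUV s (hT.trans_lt hs)))
      (fun s hs => by linarith [hneg s hs])
      (fun s hs => by simpa using hmono' s (hT.trans_lt hs)))

theorem decaysAtTop_of_abs_le (hβ : β ≠ -1) (hR : 1 ≤ R)
    (h : IsReducedSolution β g U U' V V' (Set.Ioi R)) (hg : ∀ s > R, 1 / s ^ 2 ≤ g s)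
    (hVC : ∀ s > R, |V s| ≤ C * s)
    (hUV : ∀ s > R, |V s| ≤ U s) : DecaysAtTop g U U' V V' := by
  rcases lt_or_gt_of_ne hβ with hβ | hβ
  · exact noncooperative_decay hβ hR h hg hVC hUV
  -- For `β > -1` everything vanishes near infinity, so the decay is trivial.
  have hz := cooperative_eq_zero hβ hR h hg hUV
  have hd : ∀ {f f' : ℝ → ℝ}, (∀ s > R, HasDerivAt f (f' s) s) → (∀ s > R, f s = 0) →
      ∀ s > R, f' s = 0 := by
    intro f f' hf hf0 s hs
    refine (hf s hs).unique ((hasDerivAt_const s (0 : ℝ)).congr_of_eventuallyEq ?_)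
    filter_upwards [Ioi_mem_nhds hs] with x hx using hf0 x hx
  have hev := eventually_gt_atTop R
  refine ⟨tendsto_const_nhds.congr' ?_, tendsto_const_nhds.congr' ?_, tendsto_const_nhds.congr' ?_,
    tendsto_const_nhds.congr' ?_, fun ε hε => Eventually.frequently ?_⟩
  · filter_upwards [hev] with s hs using (hz s hs).1.symm
  · filter_upwards [hev] with s hs
    rw [hd h.1 (fun s hs => (hz s hs).1) s hs, mul_zero]
  · filter_upwards [hev] with s hs using (hz s hs).2.symm
  · filter_upwards [hev] with s hs
    rw [hd h.3 (fun s hs => (hz s hs).2) s hs, mul_zero]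
  · filter_upwards [hev] with s hs
    simpa [(hz s hs).1, (hz s hs).2] using hε

/-- Decay when `U + V` and `U - V` do not change sign. -/
theorem decaysAtTop_of_signs (hβ : β ≠ -1) (hR : 1 ≤ R)
    (h : IsReducedSolution β g U U' V V' (Set.Ioi R)) (hg : ∀ s > R, 1 / s ^ 2 ≤ g s)
    (hUC : ∀ s > R, |U s| ≤ C * s) (hVC : ∀ s > R, |V s| ≤ C * s)
    (hadd : (∀ s > R, 0 ≤ U s + V s) ∨ (∀ s > R, U s + V s ≤ 0))
    (hsub : (∀ s > R, 0 ≤ U s - V s) ∨ (∀ s > R, U s - V s ≤ 0)) :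
    DecaysAtTop g U U' V V' := by
  -- The four sign patterns are `|V| ≤ U`, `|U| ≤ V`, `|U| ≤ -V` and `|V| ≤ -U`, all equivalent
  -- under the symmetries of the system.
  rcases hadd with hadd | hadd <;> rcases hsub with hsub | hsub
  · exact decaysAtTop_of_abs_le hβ hR h hg hVC fun s hs =>
      abs_le.2 ⟨by linarith [hadd s hs], by linarith [hsub s hs]⟩
  · exact (decaysAtTop_of_abs_le hβ hR h.swap hg hUC fun s hs =>
      abs_le.2 ⟨by linarith [hadd s hs], by linarith [hsub s hs]⟩).swap
  · exact (decaysAtTop_of_abs_le hβ hR h.swap.neg_fst hg hUC fun s hs =>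
      abs_le.2 ⟨by linarith [hsub s hs], by linarith [hadd s hs]⟩).of_neg_fst.swap
  · exact (decaysAtTop_of_abs_le hβ hR h.neg_fst hg hVC fun s hs =>
      abs_le.2 ⟨by linarith [hsub s hs], by linarith [hadd s hs]⟩).of_neg_fst

end Exterior

/-! ### Pohozaev identities -/

section Global

theorem eq_of_hasDerivAt_zero {f : ℝ → ℝ} {D : Set ℝ} (hD : IsOpen D) (hc : Convex ℝ D)
    (hf : ∀ x ∈ D, HasDerivAt f 0 x) {x y : ℝ} (hx : x ∈ D) (hy : y ∈ D) : f x = f y :=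
  hD.is_const_of_deriv_eq_zero hc.isPreconnected
    (fun z hz => (hf z hz).differentiableAt.differentiableWithinAt) (fun z hz => (hf z hz).deriv)
    hx hy

/-- A monotone function vanishing at both ends has zero derivative. -/
theorem deriv_eq_zero_of_monotone_of_ends {Q e : ℝ → ℝ} {D : Set ℝ} (hD : IsOpen D)
    (hc : Convex ℝ D) (hQ : ∀ s ∈ D, HasDerivAt Q (e s) s) (he : ∀ s ∈ D, 0 ≤ e s)
    (hbot : ∀ s ∈ D, ∀ ε > 0, ∃ t ∈ D, t ≤ s ∧ -ε < Q t)
    (htop : ∀ s ∈ D, ∀ ε > 0, ∃ t ∈ D, s ≤ t ∧ Q t < ε) : ∀ s ∈ D, e s = 0 := by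
  have hm : MonotoneOn Q D := monotoneOn_of_hasDerivWithinAt_nonneg hc
    (fun x hx => (hQ x hx).continuousAt.continuousWithinAt) (f' := e)
    (fun x hx => (hQ x (interior_subset hx)).hasDerivWithinAt)
    (fun x hx => he x (interior_subset hx))
  have hz : ∀ s ∈ D, Q s = 0 := by
    intro s hs
    refine le_antisymm (le_of_forall_pos_lt_add fun ε hε => ?_)
      (le_of_forall_pos_lt_add fun ε hε => ?_)
    · obtain ⟨t, ht, hst, hQt⟩ := htop s hs ε hε
      linarith [hm hs ht hst]
    · obtain ⟨t, ht, hst, hQt⟩ := hbot s hs ε hε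
      linarith [hm ht hs hst]
  intro s hs
  refine (hQ s hs).unique ((hasDerivAt_const s (0 : ℝ)).congr_of_eventuallyEq ?_)
  filter_upwards [hD.mem_nhds hs] with x hx using hz x hx

variable {β C : ℝ} {U U' V V' : ℝ → ℝ}

theorem DecaysAtTop.deriv_tendsto {g : ℝ → ℝ} (h : DecaysAtTop g U U' V V') :
    Tendsto U' atTop (𝓝 0) := by
  have := h.fst'.mul tendsto_inv_atTop_zero
  rw [mul_zero] at this
  refine this.congr' ?_
  filter_upwards [eventually_gt_atTop 0] with s hs
  field_simp

theorem eq_zero_of_deriv_eq_zero_of_tendsto {D : Set ℝ} (hD : IsOpen D) (hc : Convex ℝ D)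
    (hDtop : D ∈ atTop) (hU : ∀ s ∈ D, HasDerivAt U (U' s) s) (h0 : ∀ s ∈ D, U' s = 0)
    (hl : Tendsto U atTop (𝓝 0)) : ∀ s ∈ D, U s = 0 := by
  intro s hs
  refine tendsto_nhds_unique (tendsto_const_nhds.congr' ?_) hl
  filter_upwards [hDtop] with t ht
  exact eq_of_hasDerivAt_zero hD hc (fun x hx => by simpa [h0 x hx] using hU x hx) hs ht

/-- Matches the quartic potential with the weighted cubes controlled by `DecaysAtTop.freq`; the
mixed term is absorbed by the inequality `2 a² b² ≤ a⁴ + b⁴`. -/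
theorem abs_potential_le (β : ℝ) {a b : ℝ} (ha : |a| ≤ 1) (hb : |b| ≤ 1) :
    |(a ^ 4 + b ^ 4) / 4 + β * a ^ 2 * b ^ 2 / 2| ≤ (1 + |β|) * (|a| ^ 3 + |b| ^ 3) := by
  have h1 : a ^ 4 ≤ |a| ^ 3 := by
    have : a ^ 4 = |a| ^ 4 := by rw [← abs_pow, abs_of_nonneg (by positivity)]
    rw [this]
    exact pow_le_pow_of_le_one (abs_nonneg a) ha (by norm_num)
  have h2 : b ^ 4 ≤ |b| ^ 3 := by
    have : b ^ 4 = |b| ^ 4 := by rw [← abs_pow, abs_of_nonneg (by positivity)]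
    rw [this]
    exact pow_le_pow_of_le_one (abs_nonneg b) hb (by norm_num)
  have h3 : |β * (a ^ 2 * b ^ 2)| ≤ |β| * ((a ^ 4 + b ^ 4) / 2) := by
    rw [abs_mul, abs_of_nonneg (by positivity : 0 ≤ a ^ 2 * b ^ 2)]
    gcongr
    nlinarith [sq_nonneg (a ^ 2 - b ^ 2)]
  have h4 := abs_le.1 h3
  have h5 := abs_nonneg β
  have h6 : |β| * (a ^ 4 + b ^ 4) ≤ |β| * (|a| ^ 3 + |b| ^ 3) := by gcongr
  have h7 : 0 ≤ a ^ 4 := by positivity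
  have h8 : 0 ≤ b ^ 4 := by positivity
  have h9 : 0 ≤ |β| * (a ^ 4 + b ^ 4) := by positivity
  rw [abs_le]
  constructor <;> nlinarith

/-- The Pohozaev argument in the plane, in the logarithmic variable. -/
theorem planar_eq_zero (h : IsReducedSolution β (fun t => Real.exp (2 * t)) U U' V V' Set.univ)
    (hdec : DecaysAtTop (fun t => Real.exp (2 * t)) U U' V V')
    (hUC : ∀ t, |U t| ≤ C) (hVC : ∀ t, |V t| ≤ C)
    (hU' : Tendsto U' atBot (𝓝 0)) (hV' : Tendsto V' atBot (𝓝 0)) :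
    ∀ t, U t = 0 ∧ V t = 0 := by
  set F : ℝ → ℝ := fun t => (U t ^ 4 + V t ^ 4) / 4 + β * U t ^ 2 * V t ^ 2 / 2 with hF
  -- Twice the energy `(U'² + V'²) / 2 + g F` has derivative `2 g' F = 4 g F`, while `U U' + V V'`
  -- has derivative `U'² + V'² - 4 g F`. The potential cancels in the sum.
  set Q : ℝ → ℝ := fun t => (U' t ^ 2 + V' t ^ 2) + (U t * U' t + V t * V' t) +
    2 * (Real.exp (2 * t) * F t) with hQ
  have hFd : ∀ t, HasDerivAt F ((U t ^ 3 + β * U t * V t ^ 2) * U' t +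
      (V t ^ 3 + β * U t ^ 2 * V t) * V' t) t := by
    intro t
    have hu := h.1 t trivial
    have hv := h.3 t trivial
    refine ((((hu.pow 4).add (hv.pow 4)).div_const 4).add
      ((((hu.pow 2).const_mul β).mul (hv.pow 2)).div_const 2)).congr_deriv ?_
    simp
    ring
  have hQd : ∀ t, HasDerivAt Q (U' t ^ 2 + V' t ^ 2) t := by
    intro t
    have hu := h.1 t trivial
    have hv := h.3 t trivial
    have hu' := h.2 t trivial
    have hv' := h.4 t trivial
    have he : HasDerivAt (fun t : ℝ => Real.exp (2 * t)) (Real.exp (2 * t) * 2) t := by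
      simpa using ((hasDerivAt_id t).const_mul 2).exp
    refine ((((hu'.pow 2).add (hv'.pow 2)).add ((hu.mul hu').add (hv.mul hv'))).add
      ((he.mul (hFd t)).const_mul 2)).congr_deriv ?_
    simp [hF]
    ring
  have hbdd : ∀ {f f' : ℝ → ℝ} {l : Filter ℝ}, (∀ t, |f t| ≤ C) → Tendsto f' l (𝓝 0) →
      Tendsto (fun t => f t * f' t) l (𝓝 0) := by
    intro f f' l hf hf'
    exact isBoundedUnder_le_mul_tendsto_zero
      (isBoundedUnder_of ⟨C, fun t => by simpa using hf t⟩) hf'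
  have hmain : ∀ {l : Filter ℝ}, Tendsto U' l (𝓝 0) → Tendsto V' l (𝓝 0) →
      Tendsto (fun t => (U' t ^ 2 + V' t ^ 2) + (U t * U' t + V t * V' t)) l (𝓝 0) := by
    intro l h1 h2
    simpa using ((h1.pow 2).add (h2.pow 2)).add ((hbdd hUC h1).add (hbdd hVC h2))
  have hz := deriv_eq_zero_of_monotone_of_ends isOpen_univ convex_univ
    (fun s _ => hQd s) (fun s _ => by positivity) (fun s _ ε hε => ?_) (fun s _ ε hε => ?_)
  · refine fun t => ⟨?_, ?_⟩
    · refine eq_zero_of_deriv_eq_zero_of_tendsto isOpen_univ convex_univ univ_mem h.1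
        (fun s hs => ?_) hdec.fst t trivial
      have := hz s hs
      nlinarith [sq_nonneg (U' s), sq_nonneg (V' s)]
    · refine eq_zero_of_deriv_eq_zero_of_tendsto isOpen_univ convex_univ univ_mem h.3
        (fun s hs => ?_) hdec.snd t trivial
      have := hz s hs
      nlinarith [sq_nonneg (U' s), sq_nonneg (V' s)]
  · have hexp : Tendsto (fun t : ℝ => Real.exp (2 * t)) atBot (𝓝 0) :=
      Real.tendsto_exp_atBot.comp (tendsto_id.const_mul_atBot (by norm_num))
    have hFe : Tendsto (fun t => Real.exp (2 * t) * F t) atBot (𝓝 0) := by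
      have hU2 : Tendsto (fun t => U t * Real.exp (2 * t)) atBot (𝓝 0) := hbdd hUC hexp
      have hV2 : Tendsto (fun t => V t * Real.exp (2 * t)) atBot (𝓝 0) := hbdd hVC hexp
      have hU4 := hbdd hUC (hbdd hUC (hbdd hUC hU2))
      have hV4 := hbdd hVC (hbdd hVC (hbdd hVC hV2))
      have hUV := hbdd hUC (hbdd hUC (hbdd hVC hV2))
      have := ((hU4.add hV4).div_const 4).add ((hUV.const_mul β).div_const 2)
      simp only [add_zero, zero_div, mul_zero] at this
      refine this.congr fun t => ?_
      simp only [hF]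
      ring
    have hlim := (hmain hU' hV').add (hFe.const_mul 2)
    simp only [mul_zero, add_zero] at hlim
    obtain ⟨t, ht1, ht2⟩ := ((hlim.eventually_const_lt (neg_lt_zero.2 hε)).and
      (eventually_le_atBot s)).exists
    exact ⟨t, trivial, ht2, ht1⟩
  · have h1 := (hmain hdec.deriv_tendsto hdec.swap.deriv_tendsto).eventually_lt_const
      (half_pos hε)
    have hK : 0 < 1 + |β| := by positivity
    have hsmall : ∀ {f : ℝ → ℝ}, Tendsto f atTop (𝓝 0) → ∀ᶠ t in atTop, |f t| ≤ 1 := by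
      intro f hf
      have := hf.abs
      rw [abs_zero] at this
      exact this.eventually_le_const one_pos
    obtain ⟨t, ht, ht1, htU, htV, hts⟩ := ((hdec.freq (ε / (4 * (1 + |β|)))
      (by positivity)).and_eventually (h1.and ((hsmall hdec.fst).and ((hsmall hdec.snd).and
      (eventually_ge_atTop s))))).exists
    refine ⟨t, trivial, hts, ?_⟩
    have h2 := (le_abs_self _).trans (abs_potential_le β htU htV)
    have h3 := mul_le_mul_of_nonneg_left h2 (Real.exp_pos (2 * t)).le
    rw [lt_div_iff₀ (by positivity)] at ht
    simp only [hQ, hF]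
    nlinarith

/-- The Pohozaev argument in space, for the functions `s ↦ s u(s)`. -/
theorem spatial_eq_zero {a b a' b' : ℝ}
    (h : IsReducedSolution β (fun s => 1 / s ^ 2) U U' V V' (Set.Ioi 0))
    (hdec : DecaysAtTop (fun s => 1 / s ^ 2) U U' V V')
    (hU0 : Tendsto (fun s => U s / s) (𝓝[>] 0) (𝓝 a))
    (hV0 : Tendsto (fun s => V s / s) (𝓝[>] 0) (𝓝 b))
    (hU' : Tendsto U' (𝓝[>] 0) (𝓝 a')) (hV' : Tendsto V' (𝓝[>] 0) (𝓝 b')) :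
    ∀ s > 0, U s = 0 ∧ V s = 0 := by
  set F : ℝ → ℝ := fun t => (U t ^ 4 + V t ^ 4) / 4 + β * U t ^ 2 * V t ^ 2 / 2 with hF
  -- With `g = 1/s²`, four times `s` times the energy has derivative `2 (U'² + V'²) - 4 F / s²`;
  -- subtracting `U U' + V V'` cancels the potential and leaves `U'² + V'²`.
  set Q : ℝ → ℝ := fun s => 2 * (s * (U' s ^ 2 + V' s ^ 2)) - (U s * U' s + V s * V' s) +
    4 * (s⁻¹ * F s) with hQ
  have hFd : ∀ t > 0, HasDerivAt F ((U t ^ 3 + β * U t * V t ^ 2) * U' t +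
      (V t ^ 3 + β * U t ^ 2 * V t) * V' t) t := by
    intro t ht
    have hu := h.1 t ht
    have hv := h.3 t ht
    refine ((((hu.pow 4).add (hv.pow 4)).div_const 4).add
      ((((hu.pow 2).const_mul β).mul (hv.pow 2)).div_const 2)).congr_deriv ?_
    simp
    ring
  have hQd : ∀ t > 0, HasDerivAt Q (U' t ^ 2 + V' t ^ 2) t := by
    intro t ht
    have hu := h.1 t ht
    have hv := h.3 t ht
    have hu' := h.2 t ht
    have hv' := h.4 t ht
    refine (((((hasDerivAt_id t).mul ((hu'.pow 2).add (hv'.pow 2))).const_mul 2).sub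
      ((hu.mul hu').add (hv.mul hv'))).add
      (((hasDerivAt_inv (ne_of_gt ht)).mul (hFd t ht)).const_mul 4)).congr_deriv ?_
    have : t ≠ 0 := ne_of_gt ht
    simp [hF]
    field_simp
    ring
  have hid : Tendsto (fun s : ℝ => s) (𝓝[>] 0) (𝓝 0) := tendsto_id.mono_left nhdsWithin_le_nhds
  have hbot : Tendsto Q (𝓝[>] 0) (𝓝 0) := by
    have hlin : ∀ {f : ℝ → ℝ} {c : ℝ}, Tendsto (fun s => f s / s) (𝓝[>] 0) (𝓝 c) →
        Tendsto f (𝓝[>] 0) (𝓝 0) := by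
      intro f c hf
      have := hf.mul hid
      rw [mul_zero] at this
      refine this.congr' ?_
      filter_upwards [self_mem_nhdsWithin] with s hs
      rw [div_mul_cancel₀]
      exact ne_of_gt hs
    have hFe : Tendsto (fun s => s⁻¹ * F s) (𝓝[>] 0) (𝓝 0) := by
      have := (hid.pow 3).mul ((((hU0.pow 4).add (hV0.pow 4)).div_const 4).add
        ((((hU0.pow 2).const_mul β).mul (hV0.pow 2)).div_const 2))
      simp only [ne_eq, OfNat.ofNat_ne_zero, not_false_eq_true, zero_pow, zero_mul] at this
      refine this.congr' ?_
      filter_upwards [self_mem_nhdsWithin] with s hs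
      have : s ≠ 0 := ne_of_gt hs
      simp only [hF]
      field_simp
    have := (((hid.mul ((hU'.pow 2).add (hV'.pow 2))).const_mul 2).sub
      (((hlin hU0).mul hU').add ((hlin hV0).mul hV'))).add (hFe.const_mul 4)
    simpa using this
  have htop : Tendsto Q atTop (𝓝 0) := by
    have hFl : Tendsto F atTop (𝓝 0) := by
      have := (((hdec.fst.pow 4).add (hdec.snd.pow 4)).div_const 4).add
        ((((hdec.fst.pow 2).const_mul β).mul (hdec.snd.pow 2)).div_const 2)
      simpa using this
    have h1 := hdec.deriv_tendsto
    have h2 := hdec.swap.deriv_tendsto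
    have := ((((hdec.fst'.mul h1).add (hdec.snd'.mul h2)).const_mul 2).sub
      ((hdec.fst.mul h1).add (hdec.snd.mul h2))).add
      ((tendsto_inv_atTop_zero.mul hFl).const_mul 4)
    simp only [mul_zero, add_zero, sub_zero] at this
    refine this.congr fun s => ?_
    simp only [hQ]
    ring
  have hz := deriv_eq_zero_of_monotone_of_ends isOpen_Ioi (convex_Ioi 0)
    hQd (fun s _ => by positivity) (fun s hs ε hε => ?_) (fun s hs ε hε => ?_)
  · refine fun t ht => ⟨?_, ?_⟩
    · refine eq_zero_of_deriv_eq_zero_of_tendsto isOpen_Ioi (convex_Ioi 0) (Ioi_mem_atTop 0) h.1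
        (fun s hs => ?_) hdec.fst t ht
      have := hz s hs
      nlinarith [sq_nonneg (U' s), sq_nonneg (V' s)]
    · refine eq_zero_of_deriv_eq_zero_of_tendsto isOpen_Ioi (convex_Ioi 0) (Ioi_mem_atTop 0) h.3
        (fun s hs => ?_) hdec.snd t ht
      have := hz s hs
      nlinarith [sq_nonneg (U' s), sq_nonneg (V' s)]
  · obtain ⟨t, ht1, ht2⟩ := ((hbot.eventually_const_lt (neg_lt_zero.2 hε)).and
      (Ioc_mem_nhdsGT hs)).exists
    exact ⟨t, ht2.1, ht2.2, ht1⟩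
  · obtain ⟨t, ht1, ht2⟩ := ((htop.eventually_lt_const hε).and (eventually_ge_atTop s)).exists
    exact ⟨t, lt_of_lt_of_le hs ht2, ht2, ht1⟩

end Global

/-! ### The case `β = -1` -/

section Critical

/-- Backward Gronwall: if `K` bounds `|1 - q|` on `[s, t]`, then `e^{Kx} (A² + A'²)` is
nondecreasing there, and zero data at `t` force zero at `s`. -/
theorem eq_zero_of_linear_of_eq_zero {A A' q : ℝ → ℝ} {D : Set ℝ} (hc : Convex ℝ D)
    (hA : ∀ s ∈ D, HasDerivAt A (A' s) s) (hA' : ∀ s ∈ D, HasDerivAt A' (-(q s * A s)) s)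
    (hq : ContinuousOn q D) {t : ℝ} (ht : t ∈ D) (h0 : A t = 0) (h1 : A' t = 0) :
    ∀ s ∈ D, s ≤ t → A s = 0 := by
  intro s hs hst
  have hsub : Set.Icc s t ⊆ D := hc.ordConnected.out hs ht
  obtain ⟨K, hK⟩ := isCompact_Icc.exists_bound_of_continuousOn
    (continuousOn_const.sub (hq.mono hsub) : ContinuousOn (fun x => 1 - q x) (Set.Icc s t))
  set E := fun x => Real.exp (K * x) * (A x ^ 2 + A' x ^ 2) with hE
  have hEd : ∀ x ∈ D, HasDerivAt E (Real.exp (K * x) * (K * (A x ^ 2 + A' x ^ 2) +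
      2 * A x * A' x * (1 - q x))) x := by
    intro x hx
    have he : HasDerivAt (fun t : ℝ => Real.exp (K * t)) (Real.exp (K * x) * K) x := by
      simpa using ((hasDerivAt_id x).const_mul K).exp
    refine (he.mul (((hA x hx).pow 2).add ((hA' x hx).pow 2))).congr_deriv ?_
    simp
    ring
  have hm : MonotoneOn E (Set.Icc s t) := by
    refine monotoneOn_of_hasDerivWithinAt_nonneg (convex_Icc s t)
      (fun x hx => (hEd x (hsub hx)).continuousAt.continuousWithinAt)
      (fun x hx => (hEd x (hsub (interior_subset hx))).hasDerivWithinAt) (fun x hx => ?_)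
    have hk := abs_le.1 (hK x (interior_subset hx))
    simp only [Pi.sub_apply] at hk
    refine mul_nonneg (Real.exp_pos _).le ?_
    nlinarith [mul_nonneg (sub_nonneg.2 hk.2) (sq_nonneg (A x - A' x)),
      mul_nonneg (neg_le_iff_add_nonneg.1 hk.1) (sq_nonneg (A x + A' x))]
  have hle := hm (Set.left_mem_Icc.2 hst) (Set.right_mem_Icc.2 hst) hst
  simp only [hE, h0, h1] at hle
  have hpos := Real.exp_pos (K * s)
  have : A s ^ 2 + A' s ^ 2 ≤ 0 := by
    by_contra! hcon
    have := mul_pos hpos hcon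
    norm_num at hle
    linarith
  have : A s ^ 2 = 0 := by nlinarith [sq_nonneg (A s), sq_nonneg (A' s)]
  simpa using this

variable {R : ℝ} {g U U' V V' : ℝ → ℝ} {D : Set ℝ}

/-- For `β = -1` the nonlinearity factors: sum `A` and difference `B` satisfy `A'' = -g A B²` and
`B'' = -g B A²`, and both are nonnegative here. -/
theorem critical_add_or_sub_eq_zero_of_abs_le (hR : 1 ≤ R)
    (h : IsReducedSolution (-1) g U U' V V' (Set.Ioi R)) (hg : ∀ s > R, 1 / s ^ 2 ≤ g s)
    (hUV : ∀ s > R, |V s| ≤ U s) : (∀ s > R, U s + V s = 0) ∨ (∀ s > R, U s - V s = 0) := by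
  have hadd : ∀ s > R, 0 ≤ U s + V s := fun s hs => by linarith [(abs_le.1 (hUV s hs)).1]
  have hsub : ∀ s > R, 0 ≤ U s - V s := fun s hs => by linarith [(abs_le.1 (hUV s hs)).2]
  refine eq_zero_or_eq_zero_of_coupled_concave (by linarith) one_pos
    (fun s hs => (h.1 s hs).add (h.3 s hs)) (fun s hs => (h.2 s hs).add (h.4 s hs))
    (fun s hs => (h.1 s hs).sub (h.3 s hs)) (fun s hs => (h.2 s hs).sub (h.4 s hs)) hadd hsub
    (fun s hs => ?_) (fun s hs => ?_)
  · have h1 := mul_le_mul_of_nonneg_right (hg s hs)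
      (mul_nonneg (hadd s hs) (sq_nonneg (U s - V s)))
    rw [one_div, inv_mul_eq_div] at h1
    rw [one_mul]
    linarith
  · have h1 := mul_le_mul_of_nonneg_right (hg s hs)
      (mul_nonneg (hsub s hs) (sq_nonneg (U s + V s)))
    rw [one_div, inv_mul_eq_div] at h1
    rw [one_mul]
    linarith

theorem critical_add_or_sub_eq_zero_of_signs (hR : 1 ≤ R)
    (h : IsReducedSolution (-1) g U U' V V' (Set.Ioi R)) (hg : ∀ s > R, 1 / s ^ 2 ≤ g s)
    (hadd : (∀ s > R, 0 ≤ U s + V s) ∨ (∀ s > R, U s + V s ≤ 0))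
    (hsub : (∀ s > R, 0 ≤ U s - V s) ∨ (∀ s > R, U s - V s ≤ 0)) :
    (∀ s > R, U s + V s = 0) ∨ (∀ s > R, U s - V s = 0) := by
  rcases hadd with hadd | hadd <;> rcases hsub with hsub | hsub
  · exact critical_add_or_sub_eq_zero_of_abs_le hR h hg fun s hs =>
      abs_le.2 ⟨by linarith [hadd s hs], by linarith [hsub s hs]⟩
  · exact (critical_add_or_sub_eq_zero_of_abs_le hR h.swap hg fun s hs =>
      abs_le.2 ⟨by linarith [hadd s hs], by linarith [hsub s hs]⟩).imp
      (fun h s hs => by linarith [h s hs]) (fun h s hs => by linarith [h s hs])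
  · exact (critical_add_or_sub_eq_zero_of_abs_le hR h.swap.neg_fst hg fun s hs =>
      abs_le.2 ⟨by linarith [hsub s hs], by linarith [hadd s hs]⟩).symm.imp
      (fun h s hs => by linarith [h s hs]) (fun h s hs => by linarith [h s hs])
  · exact (critical_add_or_sub_eq_zero_of_abs_le hR h.neg_fst hg fun s hs =>
      abs_le.2 ⟨by linarith [hsub s hs], by linarith [hadd s hs]⟩).symm.imp
      (fun h s hs => by linarith [h s hs]) (fun h s hs => by linarith [h s hs])

/-- The difference solves a linear equation with continuous potential `g (U + V)²`, so its vanishing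
near infinity propagates backward. -/
theorem critical_sub_eq_zero (hc : Convex ℝ D) (hRD : Set.Ioi R ⊆ D)
    (h : IsReducedSolution (-1) g U U' V V' D) (hg : ContinuousOn g D)
    (hz : ∀ s > R, U s - V s = 0) : ∀ s ∈ D, U s - V s = 0 := by
  intro s hs
  rcases lt_or_ge R s with hsR | hsR
  · exact hz s hsR
  have hR1 : R < R + 1 := lt_add_one R
  have hd := (h.1 (R + 1) (hRD hR1)).sub (h.3 (R + 1) (hRD hR1))
  have h0 : U' (R + 1) - V' (R + 1) = 0 := by
    refine hd.unique ((hasDerivAt_const (R + 1) (0 : ℝ)).congr_of_eventuallyEq ?_)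
    filter_upwards [Ioi_mem_nhds hR1] with x hx using hz x hx
  refine eq_zero_of_linear_of_eq_zero (A := fun s => U s - V s) (A' := fun s => U' s - V' s)
    (q := fun s => g s * (U s + V s) ^ 2) hc
    (fun s hs => (h.1 s hs).sub (h.3 s hs))
    (fun s hs => ((h.2 s hs).sub (h.4 s hs)).congr_deriv (by ring)) ?_ (hRD hR1) (hz _ hR1) h0
    s hs (by linarith)
  have hUc : ContinuousOn U D := fun s hs => (h.1 s hs).continuousAt.continuousWithinAt
  have hVc : ContinuousOn V D := fun s hs => (h.3 s hs).continuousAt.continuousWithinAt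
  exact hg.mul ((hUc.add hVc).pow 2)

/-- For `β = -1`, a solution with `U + V` and `U - V` eventually one-signed is affine and
satisfies `V = -U` or `V = U`. -/
theorem critical_affine (hD : IsOpen D) (hc : Convex ℝ D) (hR : 1 ≤ R) (hRD : Set.Ioi R ⊆ D)
    (h : IsReducedSolution (-1) g U U' V V' D) (hg : ContinuousOn g D)
    (hg' : ∀ s > R, 1 / s ^ 2 ≤ g s)
    (hadd : (∀ s > R, 0 ≤ U s + V s) ∨ (∀ s > R, U s + V s ≤ 0))
    (hsub : (∀ s > R, 0 ≤ U s - V s) ∨ (∀ s > R, U s - V s ≤ 0)) :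
    ((∀ s ∈ D, V s = -U s) ∨ (∀ s ∈ D, V s = U s)) ∧
      ∃ p q : ℝ, ∀ s ∈ D, U' s = q ∧ U s = p + q * s := by
  have hpm : (∀ s ∈ D, V s = -U s) ∨ (∀ s ∈ D, V s = U s) := by
    rcases critical_add_or_sub_eq_zero_of_signs hR (h.mono hRD) hg' hadd hsub with h1 | h1
    · left
      intro s hs
      have := critical_sub_eq_zero hc hRD h.neg_snd hg (fun s hs => by linarith [h1 s hs]) s hs
      linarith
    · right
      intro s hs
      linarith [critical_sub_eq_zero hc hRD h hg h1 s hs]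
  refine ⟨hpm, ?_⟩
  have hsq : ∀ s ∈ D, V s ^ 2 = U s ^ 2 := by
    rcases hpm with h1 | h1 <;> intro s hs <;> rw [h1 s hs]
    ring
  -- Once `V² = U²`, the nonlinearity `U³ - U V²` is zero.
  have hU'0 : ∀ s ∈ D, HasDerivAt U' 0 s := fun s hs =>
    (h.2 s hs).congr_deriv (by rw [hsq s hs]; ring)
  have hmem : R + 1 ∈ D := hRD (lt_add_one R)
  have hU'c : ∀ s ∈ D, U' s = U' (R + 1) := fun s hs =>
    eq_of_hasDerivAt_zero hD hc hU'0 hs hmem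
  refine ⟨U (R + 1) - U' (R + 1) * (R + 1), U' (R + 1), fun s hs => ⟨hU'c s hs, ?_⟩⟩
  have := eq_of_hasDerivAt_zero (f := fun s => U s - U' (R + 1) * s) hD hc (fun x hx =>
    ((h.1 x hx).sub ((hasDerivAt_id x).const_mul (U' (R + 1)))).congr_deriv
      (by simp [hU'c x hx])) hs hmem
  linarith

end Critical

/-! ### Radial functions: Laplacian and nodal number -/

section Radial

variable {N : ℕ} {u : EuclideanSpace ℝ (Fin N) → ℝ}

/-- The derivative of the radial profile `s ↦ u (s • e)`. -/
noncomputable def profileDeriv (u : EuclideanSpace ℝ (Fin N) → ℝ) (e : EuclideanSpace ℝ (Fin N))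
    (s : ℝ) : ℝ :=
  fderiv ℝ u (s • e) e

/-- The second derivative of the radial profile `s ↦ u (s • e)`. -/
noncomputable def profileDeriv2 (u : EuclideanSpace ℝ (Fin N) → ℝ)
    (e : EuclideanSpace ℝ (Fin N)) (s : ℝ) : ℝ :=
  fderiv ℝ (fderiv ℝ u) (s • e) e e

theorem ContDiff.hasFDerivAt_fderiv (hu : ContDiff ℝ 2 u) (x : EuclideanSpace ℝ (Fin N)) :
    HasFDerivAt (fderiv ℝ u) (fderiv ℝ (fderiv ℝ u) x) x :=
  ((hu.fderiv_right (m := 1) (by norm_num)).differentiable (by norm_num) x).hasFDerivAt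

theorem ContDiff.hasDerivAt_profile (hu : ContDiff ℝ 2 u) (e : EuclideanSpace ℝ (Fin N)) (s : ℝ) :
    HasDerivAt (fun s : ℝ => u (s • e)) (profileDeriv u e s) s := by
  have h1 : HasDerivAt (fun s : ℝ => s • e) e s := by
    simpa using (hasDerivAt_id s).smul_const e
  exact ((hu.differentiable (by norm_num)) (s • e)).hasFDerivAt.comp_hasDerivAt s h1

theorem ContDiff.hasDerivAt_profileDeriv (hu : ContDiff ℝ 2 u) (e : EuclideanSpace ℝ (Fin N))
    (s : ℝ) : HasDerivAt (profileDeriv u e) (profileDeriv2 u e s) s := by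
  have h1 : HasDerivAt (fun s : ℝ => s • e) e s := by
    simpa using (hasDerivAt_id s).smul_const e
  have h2 := (hu.hasFDerivAt_fderiv (s • e)).comp_hasDerivAt s h1
  exact (h2.clm_apply (hasDerivAt_const s e)).congr_deriv (by simp [profileDeriv2])

/-- Second derivative of a radial function in a tangential direction. -/
theorem IsRadial.fderiv_fderiv_tangential (hr : IsRadial u) (hu : ContDiff ℝ 2 u)
    {e f : EuclideanSpace ℝ (Fin N)} (he : ‖e‖ = 1) (hf : ‖f‖ = 1) (hef : inner ℝ e f = 0)
    {s : ℝ} (hs : s ≠ 0) :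
    s * fderiv ℝ (fderiv ℝ u) (s • e) f f = profileDeriv u e s := by
  -- `u` is constant along this circle; its second derivative at `θ = 0` reads `s² D²u(f, f) - s
  -- Du(e) = 0`, since `c''(0) = -s e`.
  set c : ℝ → EuclideanSpace ℝ (Fin N) := fun θ => Real.cos θ • (s • e) + Real.sin θ • (s • f)
  set c' : ℝ → EuclideanSpace ℝ (Fin N) := fun θ => -Real.sin θ • (s • e) + Real.cos θ • (s • f)
  have hc : ∀ θ, HasDerivAt c (c' θ) θ := fun θ =>
    ((Real.hasDerivAt_cos θ).smul_const _).add ((Real.hasDerivAt_sin θ).smul_const _)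
  have hc' : HasDerivAt c' (-(s • e)) 0 := by
    exact (((Real.hasDerivAt_sin 0).neg.smul_const (s • e)).add
      ((Real.hasDerivAt_cos 0).smul_const (s • f))).congr_deriv (by simp)
  have hnorm : ∀ θ, ‖c θ‖ = ‖s • e‖ := by
    intro θ
    have h1 : ‖c θ‖ ^ 2 = ‖s • e‖ ^ 2 := by
      simp only [c]
      rw [norm_add_sq_real]
      simp only [norm_smul, inner_smul_left, inner_smul_right, he, hf, hef]
      simp only [mul_one, mul_zero, add_zero, Real.norm_eq_abs, mul_pow, sq_abs]
      rw [← add_mul, Real.cos_sq_add_sin_sq, one_mul]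
    exact (sq_eq_sq₀ (norm_nonneg _) (norm_nonneg _)).1 h1
  have hconst : ∀ θ, fderiv ℝ u (c θ) (c' θ) = 0 := by
    intro θ
    have h1 := ((hu.differentiable (by norm_num)) (c θ)).hasFDerivAt.comp_hasDerivAt θ (hc θ)
    refine h1.unique ?_
    have : u ∘ c = fun _ => u (s • e) := funext fun θ => hr _ _ (hnorm θ)
    rw [this]
    exact hasDerivAt_const _ _
  have h2 := ((hu.hasFDerivAt_fderiv (c 0)).comp_hasDerivAt 0 (hc 0)).clm_apply hc'
  have h3 : HasDerivAt (fun θ => fderiv ℝ u (c θ) (c' θ)) 0 0 := by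
    simp only [hconst]
    exact hasDerivAt_const _ _
  have h4 := h2.unique h3
  have hc0 : c 0 = s • e := by simp [c]
  have hc0' : c' 0 = s • f := by simp [c']
  simp only [Function.comp_apply, hc0, hc0', map_smul, map_neg, smul_apply,
    smul_eq_mul] at h4
  have h5 : s * (s * fderiv ℝ (fderiv ℝ u) (s • e) f f - profileDeriv u e s) = 0 := by
    rw [profileDeriv]; linarith
  have := (mul_eq_zero.1 h5).resolve_left hs
  linarith

/-- The Laplacian of a radial function in polar coordinates. -/
theorem IsRadial.laplacian_eq (hr : IsRadial u) (hu : ContDiff ℝ 2 u) (i : Fin N) {s : ℝ}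
    (hs : s ≠ 0) :
    s * (Δ u) (s • EuclideanSpace.basisFun (Fin N) ℝ i) =
      s * profileDeriv2 u (EuclideanSpace.basisFun (Fin N) ℝ i) s +
        (N - 1) * profileDeriv u (EuclideanSpace.basisFun (Fin N) ℝ i) s := by
  set b := EuclideanSpace.basisFun (Fin N) ℝ with hb
  rw [InnerProductSpace.laplacian_eq_iteratedFDeriv_orthonormalBasis u b]
  simp only [iteratedFDeriv_two_apply, Matrix.cons_val_zero, Matrix.cons_val_one]
  rw [← Finset.add_sum_erase _ _ (Finset.mem_univ i), mul_add, Finset.mul_sum]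
  congr 1
  -- Each of the other `N - 1` basis directions is tangential and contributes one copy of the first
  -- derivative.
  rw [Finset.sum_congr rfl fun j hj => hr.fderiv_fderiv_tangential hu (b.norm_eq_one i)
    (b.norm_eq_one j) (b.inner_eq_zero (Finset.ne_of_mem_erase hj).symm) hs]
  have hN : 1 ≤ N := by have := i.2; omega
  simp [Finset.card_erase_of_mem, Nat.cast_sub hN]

theorem IsRadial.eq_of_profile_eq (hr : IsRadial u) (hu : Continuous u)
    {e : EuclideanSpace ℝ (Fin N)} (he : ‖e‖ = 1) {c : ℝ}
    (h : ∀ s : ℝ, s > 0 → u (s • e) = c) :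
    ∀ x, u x = c := by
  intro x
  have hx : u x = u (‖x‖ • e) := hr _ _ (by simp [norm_smul, he])
  rw [hx]
  rcases (norm_nonneg x).eq_or_lt with h0 | h0
  · have hc : Continuous fun s : ℝ => u (s • e) := by fun_prop
    rw [← h0]
    refine tendsto_nhds_unique ((hc.tendsto 0).mono_left (nhdsWithin_le_nhds (s := Set.Ioi 0)))
      (tendsto_const_nhds.congr' ?_)
    filter_upwards [self_mem_nhdsWithin] with s hs using (h s hs).symm
  · exact h _ h0

/-- A radial function with finite nodal number is eventually one-signed. -/
theorem IsRadial.eventually_signed (hr : IsRadial u) (hn : nodalNumber u < ⊤)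
    {e : EuclideanSpace ℝ (Fin N)} (he : ‖e‖ = 1) :
    ∃ R : ℝ, (∀ s > R, 0 ≤ u (s • e)) ∨ (∀ s > R, u (s • e) ≤ 0) := by
  by_contra! hcon
  have hex : ∀ (n : ℕ) (R : ℝ), ∃ s > R, 0 < (-1) ^ n * u (s • e) := by
    intro n R
    obtain ⟨⟨a, ha, hua⟩, ⟨b, hb, hub⟩⟩ := hcon R
    rcases Nat.even_or_odd n with h | h
    · exact ⟨b, hb, by simpa [h.neg_one_pow] using hub⟩
    · exact ⟨a, ha, by simpa [h.neg_one_pow] using hua⟩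
  choose f hf hfs using hex
  -- Each radius lies beyond the previous one and carries the sign `(-1)^n`; starting beyond `0`
  -- makes all radii positive.
  let r : ℕ → ℝ := fun n => Nat.rec (f 0 0) (fun n x => f (n + 1) x) n
  have hmono : StrictMono r := strictMono_nat_of_lt_succ fun n => hf (n + 1) (r n)
  have hpos : ∀ n, 0 < r n := fun n => (hf 0 0).trans_le (hmono.monotone (Nat.zero_le n))
  have hsign : ∀ n, 0 < (-1) ^ n * u (r n • e) := by
    intro n
    cases n with
    | zero => exact hfs 0 0
    | succ n => exact hfs (n + 1) (r n)
  have hval : ∀ n (x : EuclideanSpace ℝ (Fin N)), ‖x‖ = r n → u x = u (r n • e) := fun n x hx =>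
    hr _ _ (by rw [hx, norm_smul, he, mul_one, Real.norm_of_nonneg (hpos n).le])
  have hall : ∀ k, HasSignChanges u k := by
    intro k
    refine ⟨fun i => r i, fun i j hij => hmono hij, fun i => hpos i, fun i x y hx hy => ?_⟩
    rw [hval i.castSucc x hx, hval i.succ y hy]
    have h1 := mul_pos (hsign (i.castSucc : ℕ)) (hsign (i.succ : ℕ))
    simp only [Fin.val_castSucc, Fin.val_succ] at h1 ⊢
    have h2 : ((-1 : ℝ) ^ (i : ℕ)) * (-1) ^ (i : ℕ) = 1 := by
      rw [← mul_pow]; simp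
    rw [pow_succ] at h1
    have h3 : (-1 : ℝ) ^ (i : ℕ) * u (r i • e) * ((-1) ^ (i : ℕ) * -1 * u (r (i + 1) • e)) =
      -(((-1 : ℝ) ^ (i : ℕ) * (-1) ^ (i : ℕ)) * (u (r i • e) * u (r (i + 1) • e))) := by ring
    rw [h3, h2] at h1
    linarith
  obtain ⟨m, hm⟩ := ENat.ne_top_iff_exists.1 hn.ne
  have : ((m + 1 : ℕ) : ℕ∞) ≤ nodalNumber u :=
    le_iSup₂ (f := fun (k : ℕ) (_ : HasSignChanges u k) => (k : ℕ∞)) (m + 1) (hall (m + 1))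
  rw [← hm, Nat.cast_le] at this
  omega

theorem IsRadial.add {v : EuclideanSpace ℝ (Fin N) → ℝ} (hu : IsRadial u) (hv : IsRadial v) :
    IsRadial fun x => u x + v x := fun x y h => by
  simp only [hu x y h, hv x y h]

theorem IsRadial.sub {v : EuclideanSpace ℝ (Fin N) → ℝ} (hu : IsRadial u) (hv : IsRadial v) :
    IsRadial fun x => u x - v x := fun x y h => by
  simp only [hu x y h, hv x y h]

end Radial

/-! ### Reduction of the radial profiles -/

section Liouville

/-- In `t = log s` the second derivative is `s (s φ'' + φ')`, which removes the first-order term and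
produces the weight `e^{2t}`. -/
theorem planar_profile {β R C : ℝ} {φ φ' φ'' ψ ψ' ψ'' : ℝ → ℝ} (hR : 1 ≤ R)
    (hφ : ∀ s, HasDerivAt φ (φ' s) s) (hφ' : ∀ s, HasDerivAt φ' (φ'' s) s)
    (hψ : ∀ s, HasDerivAt ψ (ψ' s) s) (hψ' : ∀ s, HasDerivAt ψ' (ψ'' s) s)
    (eφ : ∀ s > 0, s * φ'' s + φ' s = -(s * (φ s ^ 3 + β * φ s * ψ s ^ 2)))
    (eψ : ∀ s > 0, s * ψ'' s + ψ' s = -(s * (ψ s ^ 3 + β * φ s ^ 2 * ψ s)))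
    (hφC : ∀ s, |φ s| ≤ C) (hψC : ∀ s, |ψ s| ≤ C)
    (hadd : (∀ s > R, 0 ≤ φ s + ψ s) ∨ (∀ s > R, φ s + ψ s ≤ 0))
    (hsub : (∀ s > R, 0 ≤ φ s - ψ s) ∨ (∀ s > R, φ s - ψ s ≤ 0)) :
    (β ≠ -1 → ∀ s > 0, φ s = 0 ∧ ψ s = 0) ∧
    (β = -1 → ∃ c : ℝ, (∀ s > 0, φ s = c) ∧ ((∀ s > 0, ψ s = -c) ∨ (∀ s > 0, ψ s = c))) := by
  have hC : 0 ≤ C := (abs_nonneg _).trans (hφC 0)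
  have hred : IsReducedSolution β (fun t => Real.exp (2 * t)) (fun t => φ (Real.exp t))
      (fun t => Real.exp t * φ' (Real.exp t)) (fun t => ψ (Real.exp t))
      (fun t => Real.exp t * ψ' (Real.exp t)) Set.univ := by
    have he2 : ∀ t, Real.exp (2 * t) = Real.exp t * Real.exp t := fun t => by
      rw [← Real.exp_add]; ring_nf
    refine ⟨fun t _ => ?_, fun t _ => ?_, fun t _ => ?_, fun t _ => ?_⟩
    · exact ((hφ _).comp t (Real.hasDerivAt_exp t)).congr_deriv (by ring)
    · refine ((Real.hasDerivAt_exp t).mul ((hφ' _).comp t (Real.hasDerivAt_exp t))).congr_deriv ?_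
      have := eφ _ (Real.exp_pos t)
      simp only [he2, Function.comp_apply]
      linear_combination Real.exp t * this
    · exact ((hψ _).comp t (Real.hasDerivAt_exp t)).congr_deriv (by ring)
    · refine ((Real.hasDerivAt_exp t).mul ((hψ' _).comp t (Real.hasDerivAt_exp t))).congr_deriv ?_
      have := eψ _ (Real.exp_pos t)
      simp only [he2, Function.comp_apply]
      linear_combination Real.exp t * this
  have hg : ∀ t > R, 1 / t ^ 2 ≤ Real.exp (2 * t) := by
    intro t ht
    have h1 : 1 ≤ Real.exp (2 * t) := Real.one_le_exp (by linarith)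
    have h2 : 1 / t ^ 2 ≤ 1 := by
      rw [div_le_one (by nlinarith)]
      nlinarith
    linarith
  have hexp : ∀ t > R, Real.exp t > R := fun t ht => by linarith [Real.add_one_le_exp t]
  have hadd' : (∀ t > R, 0 ≤ φ (Real.exp t) + ψ (Real.exp t)) ∨
      (∀ t > R, φ (Real.exp t) + ψ (Real.exp t) ≤ 0) :=
    hadd.imp (fun h t ht => h _ (hexp t ht)) (fun h t ht => h _ (hexp t ht))
  have hsub' : (∀ t > R, 0 ≤ φ (Real.exp t) - ψ (Real.exp t)) ∨
      (∀ t > R, φ (Real.exp t) - ψ (Real.exp t) ≤ 0) :=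
    hsub.imp (fun h t ht => h _ (hexp t ht)) (fun h t ht => h _ (hexp t ht))
  have hbot : ∀ {f f' : ℝ → ℝ}, (∀ s, HasDerivAt f (f' s) s) →
      Tendsto (fun t => Real.exp t * f (Real.exp t)) atBot (𝓝 0) := by
    intro f f' hf
    have h1 : Tendsto (fun t => f (Real.exp t)) atBot (𝓝 (f 0)) :=
      ((hf 0).continuousAt.tendsto).comp Real.tendsto_exp_atBot
    simpa using Real.tendsto_exp_atBot.mul h1
  constructor
  · intro hβ s hs
    have hlin : ∀ {f : ℝ → ℝ}, (∀ s, |f s| ≤ C) → ∀ t > R, |f (Real.exp t)| ≤ C * t :=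
      fun hf t ht => (hf _).trans (by nlinarith)
    have hdec := decaysAtTop_of_signs hβ hR (hred.mono (Set.subset_univ _)) hg (hlin hφC)
      (hlin hψC) hadd' hsub'
    have := planar_eq_zero hred hdec (fun t => hφC _) (fun t => hψC _) (hbot hφ') (hbot hψ')
      (Real.log s)
    rwa [Real.exp_log hs] at this
  · rintro rfl
    obtain ⟨hpm, p, q, hpq⟩ := critical_affine isOpen_univ convex_univ hR (Set.subset_univ _) hred
      (by fun_prop) hg hadd' hsub'
    -- The slope in `t` is `e^t φ'(e^t)`, which tends to `0` at the origin: regularity excludes the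
    -- logarithmic solution.
    have hq : q = 0 := tendsto_nhds_unique
      (tendsto_const_nhds.congr fun t => ((hpq t trivial).1).symm) (hbot hφ')
    have hφp : ∀ s > 0, φ s = p := by
      intro s hs
      have := (hpq (Real.log s) trivial).2
      rw [Real.exp_log hs, hq] at this
      linarith
    refine ⟨p, hφp, hpm.imp (fun h s hs => ?_) (fun h s hs => ?_)⟩
    all_goals
      have := h (Real.log s) trivial
      rwa [Real.exp_log hs, hφp s hs] at this

/-- Here `(s φ)'' = s φ'' + 2 φ'`, and rewriting `s φ³` as `(s φ)³ / s²` gives the weight `1/s²`. -/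
theorem spatial_profile {β R C : ℝ} {φ φ' φ'' ψ ψ' ψ'' : ℝ → ℝ} (hR : 1 ≤ R)
    (hφ : ∀ s, HasDerivAt φ (φ' s) s) (hφ' : ∀ s, HasDerivAt φ' (φ'' s) s)
    (hψ : ∀ s, HasDerivAt ψ (ψ' s) s) (hψ' : ∀ s, HasDerivAt ψ' (ψ'' s) s)
    (eφ : ∀ s > 0, s * φ'' s + 2 * φ' s = -(s * (φ s ^ 3 + β * φ s * ψ s ^ 2)))
    (eψ : ∀ s > 0, s * ψ'' s + 2 * ψ' s = -(s * (ψ s ^ 3 + β * φ s ^ 2 * ψ s)))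
    (hφC : ∀ s, |φ s| ≤ C) (hψC : ∀ s, |ψ s| ≤ C)
    (hadd : (∀ s > R, 0 ≤ φ s + ψ s) ∨ (∀ s > R, φ s + ψ s ≤ 0))
    (hsub : (∀ s > R, 0 ≤ φ s - ψ s) ∨ (∀ s > R, φ s - ψ s ≤ 0)) :
    (β ≠ -1 → ∀ s > 0, φ s = 0 ∧ ψ s = 0) ∧
    (β = -1 → ∃ c : ℝ, (∀ s > 0, φ s = c) ∧ ((∀ s > 0, ψ s = -c) ∨ (∀ s > 0, ψ s = c))) := by
  have hred : IsReducedSolution β (fun s => 1 / s ^ 2) (fun s => s * φ s)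
      (fun s => φ s + s * φ' s) (fun s => s * ψ s) (fun s => ψ s + s * ψ' s) (Set.Ioi 0) := by
    refine ⟨fun s hs => ?_, fun s hs => ?_, fun s hs => ?_, fun s hs => ?_⟩
    · exact ((hasDerivAt_id s).mul (hφ s)).congr_deriv (by simp)
    · refine ((hφ s).add ((hasDerivAt_id s).mul (hφ' s))).congr_deriv ?_
      have := eφ s hs
      have hs0 : s ≠ 0 := ne_of_gt hs
      simp only [id_eq]
      field_simp
      linear_combination this
    · exact ((hasDerivAt_id s).mul (hψ s)).congr_deriv (by simp)
    · refine ((hψ s).add ((hasDerivAt_id s).mul (hψ' s))).congr_deriv ?_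
      have := eψ s hs
      have hs0 : s ≠ 0 := ne_of_gt hs
      simp only [id_eq]
      field_simp
      linear_combination this
  have hRD : Set.Ioi R ⊆ Set.Ioi 0 := Set.Ioi_subset_Ioi (by linarith)
  have hadd' : (∀ s > R, 0 ≤ s * φ s + s * ψ s) ∨ (∀ s > R, s * φ s + s * ψ s ≤ 0) := by
    simp only [← mul_add]
    exact hadd.imp (fun h s hs => mul_nonneg (by linarith) (h s hs))
      (fun h s hs => mul_nonpos_of_nonneg_of_nonpos (by linarith) (h s hs))
  have hsub' : (∀ s > R, 0 ≤ s * φ s - s * ψ s) ∨ (∀ s > R, s * φ s - s * ψ s ≤ 0) := by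
    simp only [← mul_sub]
    exact hsub.imp (fun h s hs => mul_nonneg (by linarith) (h s hs))
      (fun h s hs => mul_nonpos_of_nonneg_of_nonpos (by linarith) (h s hs))
  have hquot : ∀ {f f' : ℝ → ℝ}, (∀ s, HasDerivAt f (f' s) s) →
      Tendsto (fun s => s * f s / s) (𝓝[>] 0) (𝓝 (f 0)) := by
    intro f f' hf
    refine ((hf 0).continuousAt.tendsto.mono_left nhdsWithin_le_nhds).congr' ?_
    filter_upwards [self_mem_nhdsWithin] with s hs
    have : s ≠ 0 := ne_of_gt hs
    field_simp
  have hder : ∀ {f f' f'' : ℝ → ℝ}, (∀ s, HasDerivAt f (f' s) s) → (∀ s, HasDerivAt f' (f'' s) s) →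
      Tendsto (fun s => f s + s * f' s) (𝓝[>] 0) (𝓝 (f 0 + 0 * f' 0)) := by
    intro f f' f'' hf hf'
    exact ((hf 0).continuousAt.add (continuousAt_id.mul (hf' 0).continuousAt)).tendsto.mono_left
      nhdsWithin_le_nhds
  constructor
  · intro hβ s hs
    have hlin : ∀ {f : ℝ → ℝ}, (∀ s, |f s| ≤ C) → ∀ s > R, |s * f s| ≤ C * s := by
      intro f hf s hs
      have hs0 : 0 ≤ s := by linarith
      rw [abs_mul, abs_of_nonneg hs0, mul_comm]
      exact mul_le_mul_of_nonneg_right (hf s) hs0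
    have hdec := decaysAtTop_of_signs hβ hR (hred.mono hRD) (fun s _ => le_rfl) (hlin hφC)
      (hlin hψC) hadd' hsub'
    have := spatial_eq_zero hred hdec (hquot hφ) (hquot hψ) (hder hφ hφ') (hder hψ hψ') s hs
    simpa [ne_of_gt hs] using this
  · rintro rfl
    obtain ⟨hpm, p, q, hpq⟩ := critical_affine isOpen_Ioi (convex_Ioi 0) hR hRD hred
      (continuousOn_const.div (by fun_prop) fun s hs => pow_ne_zero 2 (ne_of_gt hs))
      (fun s _ => le_rfl) hadd' hsub'
    -- `s φ(s)` tends to `0` at the origin, which excludes the singular solution `p / s`; the slope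
    -- `q` survives as the constant value of `φ`.
    have hp : p = 0 := by
      have h1 : Tendsto (fun s : ℝ => s * φ s) (𝓝[>] 0) (𝓝 (0 * φ 0)) :=
        (continuousAt_id.mul (hφ 0).continuousAt).tendsto.mono_left nhdsWithin_le_nhds
      have h2 : Tendsto (fun s : ℝ => p + q * s) (𝓝[>] 0) (𝓝 (p + q * 0)) :=
        (Continuous.tendsto (by fun_prop) 0).mono_left nhdsWithin_le_nhds
      have := tendsto_nhds_unique (h2.congr' (by
        filter_upwards [self_mem_nhdsWithin] with s hs using ((hpq s hs).2).symm)) h1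
      simpa using this
    have hφq : ∀ s > 0, φ s = q := by
      intro s hs
      have := (hpq s hs).2
      rw [hp, zero_add, mul_comm q] at this
      exact mul_left_cancel₀ (ne_of_gt hs) this
    refine ⟨q, hφq, hpm.imp (fun h s hs => ?_) (fun h s hs => ?_)⟩
    · have := h s hs
      rw [hφq s hs, ← mul_neg] at this
      exact mul_left_cancel₀ (ne_of_gt hs) this
    · have := h s hs
      rw [hφq s hs] at this
      exact mul_left_cancel₀ (ne_of_gt hs) this

end Liouville

/-! ### The theorem on `ℝ^N` -/

theorem theoremt (N : ℕ) (hN : N = 2 ∨ N = 3) (β : ℝ)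
    (u v : EuclideanSpace ℝ (Fin N) → ℝ)
    (hsol : IsBoundedRadialSolution β u v)
    (hadd : nodalNumber (fun x => u x + v x) < ⊤)
    (hsub : nodalNumber (fun x => u x - v x) < ⊤) :
    (β ≠ -1 → (∀ x, u x = 0) ∧ (∀ x, v x = 0)) ∧
    (β = -1 → ∃ c : ℝ, (∀ x, u x = c) ∧ ((∀ x, v x = -c) ∨ (∀ x, v x = c))) := by
  have hN0 : 0 < N := by omega
  set e := EuclideanSpace.basisFun (Fin N) ℝ ⟨0, hN0⟩ with he_def
  have he : ‖e‖ = 1 := (EuclideanSpace.basisFun (Fin N) ℝ).norm_eq_one _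
  obtain ⟨R₁, h₁⟩ := (hsol.radial_u.add hsol.radial_v).eventually_signed hadd he
  obtain ⟨R₂, h₂⟩ := (hsol.radial_u.sub hsol.radial_v).eventually_signed hsub he
  obtain ⟨C₁, hC₁⟩ := hsol.bounded_u
  obtain ⟨C₂, hC₂⟩ := hsol.bounded_v
  have hR : 1 ≤ max 1 (max R₁ R₂) := le_max_left _ _
  have hR₁ : R₁ ≤ max 1 (max R₁ R₂) := (le_max_left _ _).trans (le_max_right _ _)
  have hR₂ : R₂ ≤ max 1 (max R₁ R₂) := (le_max_right _ _).trans (le_max_right _ _)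
  have hu := hsol.contDiff_u.hasDerivAt_profile e
  have hu' := hsol.contDiff_u.hasDerivAt_profileDeriv e
  have hv := hsol.contDiff_v.hasDerivAt_profile e
  have hv' := hsol.contDiff_v.hasDerivAt_profileDeriv e
  have hub : ∀ s : ℝ, |u (s • e)| ≤ max C₁ C₂ := fun s => (hC₁ _).trans (le_max_left _ _)
  have hvb : ∀ s : ℝ, |v (s • e)| ≤ max C₁ C₂ := fun s => (hC₂ _).trans (le_max_right _ _)
  have equ : ∀ s > 0, s * profileDeriv2 u e s + (N - 1) * profileDeriv u e s =
      -(s * (u (s • e) ^ 3 + β * u (s • e) * v (s • e) ^ 2)) := fun s hs => by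
    rw [← hsol.eq_u, ← hsol.radial_u.laplacian_eq hsol.contDiff_u _ (ne_of_gt hs)]
    ring
  have eqv : ∀ s > 0, s * profileDeriv2 v e s + (N - 1) * profileDeriv v e s =
      -(s * (v (s • e) ^ 3 + β * u (s • e) ^ 2 * v (s • e))) := fun s hs => by
    rw [← hsol.eq_v, ← hsol.radial_v.laplacian_eq hsol.contDiff_v _ (ne_of_gt hs)]
    ring
  have hs₁ := h₁.imp (fun h s (hs : s > max 1 (max R₁ R₂)) => h s (hR₁.trans_lt hs))
    (fun h s (hs : s > max 1 (max R₁ R₂)) => h s (hR₁.trans_lt hs))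
  have hs₂ := h₂.imp (fun h s (hs : s > max 1 (max R₁ R₂)) => h s (hR₂.trans_lt hs))
    (fun h s (hs : s > max 1 (max R₁ R₂)) => h s (hR₂.trans_lt hs))
  have key : (β ≠ -1 → ∀ s : ℝ, s > 0 → u (s • e) = 0 ∧ v (s • e) = 0) ∧
      (β = -1 → ∃ c : ℝ, (∀ s : ℝ, s > 0 → u (s • e) = c) ∧
        ((∀ s : ℝ, s > 0 → v (s • e) = -c) ∨ (∀ s : ℝ, s > 0 → v (s • e) = c))) := by
    have hN' : (N : ℝ) = 2 ∨ (N : ℝ) = 3 := by exact_mod_cast hN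
    rcases hN' with h | h
    · refine planar_profile hR hu hu' hv hv' (fun s hs => ?_) (fun s hs => ?_) hub hvb hs₁ hs₂
      · rw [← equ s hs, h]; ring
      · rw [← eqv s hs, h]; ring
    · refine spatial_profile hR hu hu' hv hv' (fun s hs => ?_) (fun s hs => ?_) hub hvb hs₁ hs₂
      · rw [← equ s hs, h]; ring
      · rw [← eqv s hs, h]; ring
  have hfu : ∀ {c : ℝ}, (∀ s : ℝ, s > 0 → u (s • e) = c) → ∀ x, u x = c := fun h =>
    hsol.radial_u.eq_of_profile_eq hsol.contDiff_u.continuous he h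
  have hfv : ∀ {c : ℝ}, (∀ s : ℝ, s > 0 → v (s • e) = c) → ∀ x, v x = c := fun h =>
    hsol.radial_v.eq_of_profile_eq hsol.contDiff_v.continuous he h
  refine ⟨fun hβ => ⟨hfu fun s hs => (key.1 hβ s hs).1, hfv fun s hs => (key.1 hβ s hs).2⟩,
    fun hβ => ?_⟩
  obtain ⟨c, hc, hcv⟩ := key.2 hβ
  exact ⟨c, hfu hc, hcv.imp hfv hfv⟩
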